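/- **Setting.** Let $F:\mathbb R^d\times\mathbb R^d\to(0,\infty)$ be measurable, integrable, $\iint F\,dx\,dv=1$, and let $\mathcal H=L^2(F^{-1}dx\,dv)$ (real functions) with its norm $\|\cdot\|$ and inner product $\langle\cdot,\cdot\rangle$. Let $\Pi f=\frac{\int f\,dv}{\int F\,dv}F$, which is the orthogonal projection of $\mathcal H$ onto the local equilibria $\{\rho(x)F(x,v)\}$. Let * $\mathsf T$ be a densely defined, closed, skew symmetric operator in $\mathcal H$ such that $\{f\in D(\mathsf T):\Pi f\in D(\mathsf T)\}$ is a core of $\mathsf T$; * $\mathsf L$ be a bounded symmetric operator on $\mathcal H$ (independent of $z$) that acts on the variable $v$ only (it commutes with multiplication by bounded measurable functions of $x$) and has null space $\{\rho(x)F(x,v)\}\cap\mathcal H$, with $\mathrm{Null}\,\mathsf L\cap\mathrm{Null}\,\mathsf T=\mathrm{Span}\{F\}$. Let $\Omega$ be a convex set with non-empty interior in a finite-dimensional real normed space (the range of finitely many random variables $z$; for one random variable an interval of $\mathbb R$). $\partial_z^l$ denotes the $l$-th (Fréchet) derivative in $z\in\Omega$, measured in the operator norm of $l$-linear maps; for $\Omega\subseteq\mathbb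 R$ it is the usual $l$-th derivative. Let $\mathsf L_z=\sigma(x,z)\mathsf L$, where $\sigma(\cdot,z)$ is measurable for each $z\in\Omega$ and $\sigma(x,\cdot)$ is $C^\infty$ on $\Omega$ for each $x$. **Hypocoercivity assumptions.** There are constants $\alpha,\beta>0$ and $\gamma$, independent of $z$, such that for every $z\in\Omega$ the operator $\mathsf L_z$ is symmetric and 1. $-\langle\mathsf L_zf,f\rangle\ge\alpha\|(1-\Pi)f\|^2$ for all $f\in\mathcal H$; 2. $\|\mathsf T\Pi f\|^2\ge\beta\|\Pi f\|^2$ for all $f\in\mathcal H$ with $\iint f\,dx\,dv=0$ and $\Pi f\in D(\mathsf T)$; 3. $\Pi\mathsf T\Pi f=0$ whenever $\Pi f\in D(\mathsf T)$; 4. $\|\mathsf A\mathsf T(1-\Pi)f\|+\|\mathsf A\mathsf L_zf\|\le\gamma\|(1-\Pi)f\|$ whenever $(1-\Pi)f\in D(\mathsf T)$, where $\mathsf A=(1+(\mathsf T\Pi)^*(\mathsf T\Pi))^{-1}(\mathsf T\Pi)^*$, extended to a bounded operator on $\mathcal H$. **Theorem.** Let $C_2,H\in\mathbb R$ be such that for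 all integers $l\ge0$ and all $z\in\Omega$ $$\Big|\frac{\partial_z^l\sigma(x,z)}{l!}\Big|\le C_2\quad\text{for all }x,\qquad \|\partial_z^lf_0(z)\|\le H^l,$$ where $z\mapsto f_0(z)\in\mathcal H$ is $C^\infty$ on $\Omega$ and $\iint f_0(z)\,dx\,dv=0$ for all $z\in\Omega$. For every $z\in\Omega$ let $f(t,z)$, $t\ge0$, be the (mild) solution in $\mathcal H$ of $$\partial_tf+\mathsf Tf=\mathsf L_zf,\qquad f(0,z)=f_0(z),$$ that is, $t\mapsto f(t,z)\in\mathcal H$ is continuous, $\int_0^tf\,ds\in D(\mathsf T)$ and $f(t)=f_0-\mathsf T\int_0^tf\,ds+\mathsf L_z\int_0^tf\,ds$ for all $t\ge 0$. Then: * for every $t\ge0$ the map $z\mapsto f(t,z)\in\mathcal H$ is $C^\infty$ on $\Omega$ and analytic at every $z_0\in\Omega$, with radius of convergence at least $\frac1{2(1+H)}$: the series $\sum_l\frac{1}{l!}\partial_z^lf(t,z_0)(z-z_0)^l$ has at least this radius of convergence in $\mathcal H$, and its sum is $f(t,z)$ for all $z\in\Omega$ with $|z-z_0|<\frac1{2(1+H)}$;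 * all $z$-derivatives of $f$ decay exponentially in time: there is $\lambda>0$ such that for every $l\ge0$ there is a constant $C_l$ with $\|\partial_z^lf(t,z)\|\le C_le^{-\lambda t}$ for all $t\ge0$ and $z\in\Omega$. -/

import Mathlib

open MeasureTheory Set
open scoped InnerProductSpace ContDiff

noncomputable section

namespace Kinetic

section HilbertOperators
variable {H : Type*} [NormedAddCommGroup H] [InnerProductSpace ℝ H]

/-- The composition `T ∘ P` of an unbounded operator `T` with a bounded operator `P`, on its
natural domain `{f | P f ∈ D(T)}`. -/
def compBounded (T : H →ₗ.[ℝ] H) (P : H →L[ℝ] H) : H →ₗ.[ℝ] H where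
  domain := T.domain.comap P.toLinearMap
  toFun := T.toFun ∘ₗ (P.toLinearMap.restrict (p := T.domain.comap P.toLinearMap)
    (q := T.domain) fun _ h => h)

/-- The graph of `X` inside the Hilbert space `H ⊕ H`. -/
def hilbertGraph (X : H →ₗ.[ℝ] H) : Submodule ℝ (WithLp 2 (H × H)) :=
  X.graph.comap (WithLp.linearEquiv 2 ℝ (H × H)).toLinearMap

theorem isClosed_hilbertGraph {X : H →ₗ.[ℝ] H} (hX : X.IsClosed) :
    IsClosed (hilbertGraph X : Set (WithLp 2 (H × H))) :=
  IsClosed.preimage (f := WithLp.prodContinuousLinearEquiv 2 ℝ H H)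
    (ContinuousLinearEquiv.continuous _) hX

variable [CompleteSpace H]

/-- The bounded operator `A = (1 + X* X)⁻¹ X*`, built everywhere on `H`: `A f` is the first
component of the orthogonal projection of `(0, f)` onto the (closed) graph of `X`. -/
def auxOperator (X : H →ₗ.[ℝ] H) : H →L[ℝ] H :=
  ContinuousLinearMap.fst ℝ H H ∘L
    (WithLp.prodContinuousLinearEquiv 2 ℝ H H).toContinuousLinearMap ∘L
    (hilbertGraph X).topologicalClosure.starProjection ∘L
    (WithLp.prodContinuousLinearEquiv 2 ℝ H H).symm.toContinuousLinearMap ∘L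
    ContinuousLinearMap.inr ℝ H H

/-- Weak form of `(1 + X* X) (A f) = X* f`. -/
theorem auxOperator_weak {X : H →ₗ.[ℝ] H} (hX : X.IsClosed) (f : H) :
    ∃ h : auxOperator X f ∈ X.domain, ∀ k : X.domain,
      ⟪auxOperator X f, (k : H)⟫_ℝ + ⟪X ⟨auxOperator X f, h⟩, X k⟫_ℝ = ⟪f, X k⟫_ℝ := by
  set w : WithLp 2 (H × H) := WithLp.toLp 2 ((0 : H), f) with hw
  set u := (hilbertGraph X).topologicalClosure.starProjection w with hu
  have hA : auxOperator X f = u.fst := rfl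
  have hmem : u ∈ hilbertGraph X := by
    have : u ∈ (hilbertGraph X).topologicalClosure := Submodule.starProjection_apply_mem _ _
    rwa [(isClosed_hilbertGraph hX).submodule_topologicalClosure_eq] at this
  have hg : (u.fst, u.snd) ∈ X.graph := hmem
  obtain ⟨y, hy1, hy2⟩ := (LinearPMap.mem_graph_iff X).1 hg
  simp only at hy1 hy2
  have hdom : auxOperator X f ∈ X.domain := by rw [hA, ← hy1]; exact y.2
  refine ⟨hdom, fun k => ?_⟩
  have hXe : X ⟨auxOperator X f, hdom⟩ = u.snd := by
    rw [← hy2]; congr 1; exact Subtype.ext (hA.trans hy1.symm)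
  have hk : WithLp.toLp 2 ((k : H), X k) ∈ (hilbertGraph X).topologicalClosure :=
    Submodule.le_topologicalClosure _ (LinearPMap.mem_graph X k)
  have h0 := Submodule.starProjection_inner_eq_zero w _ hk
  rw [← hu, inner_sub_left, WithLp.prod_inner_apply, WithLp.prod_inner_apply] at h0
  simp only [hw, inner_zero_left] at h0
  rw [hXe, hA]
  simp only [WithLp.ofLp_fst, WithLp.ofLp_snd, zero_add] at h0 ⊢
  linarith

/-- Strong form: for `f ∈ D(X*)`, `A f + X* X A f = X* f`. -/
theorem auxOperator_strong {X : H →ₗ.[ℝ] H} (hX : X.IsClosed)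
    (hd : Dense (X.domain : Set H)) (f : X.adjoint.domain) :
    ∃ (h : auxOperator X f ∈ X.domain)
      (h' : X ⟨auxOperator X f, h⟩ ∈ X.adjoint.domain),
      auxOperator X f + X.adjoint ⟨X ⟨auxOperator X f, h⟩, h'⟩ = X.adjoint f := by
  obtain ⟨h, hw⟩ := auxOperator_weak hX (f : H)
  have key : ∀ k : X.domain, ⟪X.adjoint f - auxOperator X f, (k : H)⟫_ℝ
      = ⟪X ⟨auxOperator X f, h⟩, X k⟫_ℝ := fun k => by
    have h1 := LinearPMap.adjoint_isFormalAdjoint hd f k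
    rw [inner_sub_left, h1]
    linarith [hw k]
  have h' := LinearPMap.mem_adjoint_domain_of_exists (T := X)
    (X ⟨auxOperator X f, h⟩) ⟨_, key⟩
  refine ⟨h, h', ?_⟩
  rw [LinearPMap.adjoint_apply_eq hd ⟨_, h'⟩ key]
  abel

end HilbertOperators
/-- Position (or velocity) space `ℝ^d`. -/
abbrev Pos (d : ℕ) := EuclideanSpace ℝ (Fin d)

/-- Phase space `ℝ^d × ℝ^d` of points `(x, v)`, with Lebesgue measure `volume`. -/
abbrev Phase (d : ℕ) := Pos d × Pos d

variable {d : ℕ}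

/-- The measure `dμ = F⁻¹ dx dv`. -/
def weight (F : Phase d → ℝ) : Measure (Phase d) :=
  volume.withDensity fun p => ENNReal.ofReal (F p)⁻¹

/-- The Hilbert space `L²(F⁻¹ dx dv)` of real functions. -/
abbrev KSpace (F : Phase d → ℝ) := Lp ℝ 2 (weight F)

/-- `F` is strictly positive, integrable and normalized. -/
structure IsEquilibriumDensity (F : Phase d → ℝ) : Prop where
  measurable : Measurable F
  pos : ∀ p, 0 < F p
  integrable : Integrable F
  integral_eq_one : ∫ p, F p = 1

/-- The total mass `∬ f dx dv`. -/
def mass (F : Phase d → ℝ) (f : KSpace F) : ℝ := ∫ p, f p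

/-- The space of local equilibria `ρ(x) F(x, v)`. Any positive local equilibrium may be used in
place of `F` here: it differs from `F` by a factor depending on `x` only. -/
def localEquilibria (F : Phase d → ℝ) : Submodule ℝ (KSpace F) where
  carrier := {f | ∃ ρ : Pos d → ℝ, Measurable ρ ∧ f =ᵐ[weight F] fun p => ρ p.1 * F p}
  add_mem' := by
    rintro f g ⟨ρ, hρ, hf⟩ ⟨τ, hτ, hg⟩
    refine ⟨ρ + τ, hρ.add hτ, ?_⟩
    filter_upwards [Lp.coeFn_add f g, hf, hg] with p h1 h2 h3
    rw [h1, Pi.add_apply, h2, h3, Pi.add_apply]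
    ring
  zero_mem' := by
    refine ⟨0, measurable_const, ?_⟩
    filter_upwards [Lp.coeFn_zero ℝ 2 (weight F)] with p h1
    rw [h1]
    simp
  smul_mem' := by
    rintro c f ⟨ρ, hρ, hf⟩
    refine ⟨c • ρ, hρ.const_smul c, ?_⟩
    filter_upwards [Lp.coeFn_smul c f, hf] with p h1 h2
    rw [h1, Pi.smul_apply, h2, Pi.smul_apply, smul_eq_mul, smul_eq_mul, mul_assoc]

theorem ae_weight_iff {F : Phase d → ℝ} (hF : IsEquilibriumDensity F) :
    ae (weight F) = ae (volume : Measure (Phase d)) := by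
  apply le_antisymm
  · exact (withDensity_absolutelyContinuous _ _).ae_le
  · refine (withDensity_absolutelyContinuous' ?_ ?_).ae_le
    · exact hF.measurable.inv.ennreal_ofReal.aemeasurable
    · exact Filter.Eventually.of_forall fun p => by
        simpa using hF.pos p

theorem integrable_weight_iff {F : Phase d → ℝ} (hF : IsEquilibriumDensity F) (g : Phase d → ℝ) :
    Integrable g (weight F) ↔ Integrable fun p => g p / F p := by
  have hm : Measurable fun p => ENNReal.ofReal (F p)⁻¹ := hF.measurable.inv.ennreal_ofReal
  rw [weight, integrable_withDensity_iff_integrable_smul' hm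
    (Filter.Eventually.of_forall fun p => ENNReal.ofReal_lt_top)]
  refine integrable_congr (Filter.Eventually.of_forall fun p => ?_)
  simp only [smul_eq_mul]
  rw [ENNReal.toReal_ofReal (inv_nonneg.2 (hF.pos p).le)]
  ring

theorem integral_weight {F : Phase d → ℝ} (hF : IsEquilibriumDensity F) (g : Phase d → ℝ) :
    ∫ p, g p ∂(weight F) = ∫ p, g p / F p := by
  have hm : Measurable fun p => ENNReal.ofReal (F p)⁻¹ := hF.measurable.inv.ennreal_ofReal
  rw [weight, integral_withDensity_eq_integral_toReal_smul hm
    (Filter.Eventually.of_forall fun p => ENNReal.ofReal_lt_top)]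
  refine integral_congr_ae (Filter.Eventually.of_forall fun p => ?_)
  simp only [smul_eq_mul]
  rw [ENNReal.toReal_ofReal (inv_nonneg.2 (hF.pos p).le)]
  ring

theorem memLp_weight_iff {F : Phase d → ℝ} (hF : IsEquilibriumDensity F) {g : Phase d → ℝ}
    (hg : AEStronglyMeasurable g) :
    MemLp g 2 (weight F) ↔ Integrable fun p => g p ^ 2 / F p := by
  have hg' : AEStronglyMeasurable g (weight F) :=
    hg.mono_ac (withDensity_absolutelyContinuous _ _)
  rw [memLp_two_iff_integrable_sq hg', integrable_weight_iff hF]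

theorem aesm_of_mem {F : Phase d → ℝ} (hF : IsEquilibriumDensity F) (f : KSpace F) :
    AEStronglyMeasurable f (volume : Measure (Phase d)) := by
  refine (Lp.aestronglyMeasurable f).mono_ac ?_
  rw [← Measure.ae_le_iff_absolutelyContinuous, ae_weight_iff hF]

theorem integrable_of_mem {F : Phase d → ℝ} (hF : IsEquilibriumDensity F) (f : KSpace F) :
    Integrable f (volume : Measure (Phase d)) := by
  have h1 : MemLp F 2 (weight F) := by
    rw [memLp_weight_iff hF hF.measurable.aestronglyMeasurable]
    refine hF.integrable.congr (Filter.Eventually.of_forall fun p => ?_)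
    have := (hF.pos p).ne'
    field_simp
  have h2 : Integrable (fun p => f p * F p) (weight F) := (Lp.memLp f).integrable_mul h1
  rw [integrable_weight_iff hF] at h2
  refine h2.congr (Filter.Eventually.of_forall fun p => ?_)
  have := (hF.pos p).ne'
  field_simp

/-- The orthogonal projection `Π` onto the local equilibria. -/
def localProj (F : Phase d → ℝ) : KSpace F →L[ℝ] KSpace F :=
  (localEquilibria F).topologicalClosure.starProjection

/-- Explicitly, `Π f = (∫ f dv / ∫ F dv) F`. -/
theorem localProj_ae_eq {F : Phase d → ℝ} (hF : IsEquilibriumDensity F) (f : KSpace F) :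
    localProj F f =ᵐ[volume]
      fun p => (∫ v, f (p.1, v)) / (∫ v, F (p.1, v)) * F p := by
  have hfi := integrable_of_mem hF f
  have hFi := hF.integrable
  set q : Pos d → ℝ := fun x => (∫ v, f (x, v)) / (∫ v, F (x, v)) with hq
  have hρf : AEStronglyMeasurable (fun x => ∫ v, f (x, v)) (volume : Measure (Pos d)) :=
    (aesm_of_mem hF f).integral_prod_right'
  have hρF : AEStronglyMeasurable (fun x => ∫ v, F (x, v)) (volume : Measure (Pos d)) :=
    hF.measurable.aestronglyMeasurable.integral_prod_right'
  have hqm : AEMeasurable q (volume : Measure (Pos d)) := hρf.aemeasurable.div hρF.aemeasurable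
  obtain ⟨ψ, hψm, hψ⟩ := hqm
  have hψ2 : ∀ᵐ p : Phase d, q p.1 = ψ p.1 :=
    (Measure.quasiMeasurePreserving_fst (μ := (volume : Measure (Pos d)))
      (ν := (volume : Measure (Pos d)))).ae hψ
  have hsq : Integrable (fun p => f p ^ 2 / F p) (volume : Measure (Phase d)) :=
    (memLp_weight_iff hF (aesm_of_mem hF f)).1 (Lp.memLp f)
  -- slices
  have s1 := Integrable.prod_right_ae (μ := (volume : Measure (Pos d)))
    (ν := (volume : Measure (Pos d))) hfi
  have s2 := Integrable.prod_right_ae (μ := (volume : Measure (Pos d)))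
    (ν := (volume : Measure (Pos d))) hFi
  have s3 := Integrable.prod_right_ae (μ := (volume : Measure (Pos d)))
    (ν := (volume : Measure (Pos d))) hsq
  have hρpos : ∀ᵐ x : Pos d, 0 < ∫ v, F (x, v) := by
    filter_upwards [s2] with x hx
    rw [integral_pos_iff_support_of_nonneg (fun v => (hF.pos _).le) hx]
    have : Function.support (fun v => F (x, v)) = univ := by
      ext v; simp [(hF.pos (x, v)).ne']
    rw [this]
    exact (Measure.measure_univ_pos).2 (NeZero.ne _)
  have hbound : ∀ᵐ x : Pos d, ψ x ^ 2 * (∫ v, F (x, v)) ≤ ∫ v, f (x, v) ^ 2 / F (x, v) := by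
    filter_upwards [s1, s2, s3, hρpos, hψ] with x h1 h2 h3 h4 h5
    have hψx : ψ x * (∫ v, F (x, v)) = ∫ v, f (x, v) := by
      rw [← h5, hq]; field_simp
    have h0 : 0 ≤ ∫ v, (f (x, v) ^ 2 / F (x, v) - 2 * ψ x * f (x, v) + ψ x ^ 2 * F (x, v)) := by
      refine integral_nonneg fun v => ?_
      have hp := hF.pos (x, v)
      have : f (x, v) ^ 2 / F (x, v) - 2 * ψ x * f (x, v) + ψ x ^ 2 * F (x, v)
          = (f (x, v) - ψ x * F (x, v)) ^ 2 / F (x, v) := by field_simp; ring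
      simp only [Pi.zero_apply]
      rw [this]; positivity
    have k1 : Integrable (fun v => 2 * ψ x * f (x, v)) := h1.const_mul _
    have k2 : Integrable (fun v => ψ x ^ 2 * F (x, v)) := h2.const_mul _
    have k3 : Integrable (fun v => f (x, v) ^ 2 / F (x, v) - 2 * ψ x * f (x, v)) := h3.sub k1
    rw [integral_add k3 k2, integral_sub h3 k1, integral_const_mul, integral_const_mul,
      ← hψx] at h0
    nlinarith
  have hgsq : Integrable (fun p : Phase d => ψ p.1 ^ 2 * F p) := by
    have hm : AEStronglyMeasurable (fun p : Phase d => ψ p.1 ^ 2 * F p) :=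
      (((hψm.comp measurable_fst).pow_const 2).mul hF.measurable).aestronglyMeasurable
    refine (integrable_prod_iff hm).2 ⟨?_, ?_⟩
    · filter_upwards [s2] with x hx using hx.const_mul _
    · have hq := Integrable.integral_prod_left (μ := (volume : Measure (Pos d)))
        (ν := (volume : Measure (Pos d))) hsq
      refine hq.mono' hm.norm.integral_prod_right' ?_
      filter_upwards [hbound] with x hx
      have : ∀ v, ‖ψ x ^ 2 * F (x, v)‖ = ψ x ^ 2 * F (x, v) := fun v =>
        Real.norm_of_nonneg (mul_nonneg (sq_nonneg _) (hF.pos _).le)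
      simp only [this]
      rw [integral_const_mul, Real.norm_of_nonneg
        (mul_nonneg (sq_nonneg _) (integral_nonneg fun v => (hF.pos _).le))]
      exact hx
  have hgm : Measurable (fun p : Phase d => ψ p.1 * F p) :=
    (hψm.comp measurable_fst).mul hF.measurable
  have hgL : MemLp (fun p : Phase d => ψ p.1 * F p) 2 (weight F) := by
    rw [memLp_weight_iff hF hgm.aestronglyMeasurable]
    refine hgsq.congr (Filter.Eventually.of_forall fun p => ?_)
    have := (hF.pos p).ne'
    field_simp
  set g : KSpace F := hgL.toLp _ with hg
  have hgae : g =ᵐ[volume] fun p => ψ p.1 * F p := by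
    rw [← ae_weight_iff hF]; exact hgL.coeFn_toLp
  have hgmem : g ∈ localEquilibria F := ⟨ψ, hψm, hgL.coeFn_toLp⟩
  have horth : ∀ w ∈ localEquilibria F, ⟪f - g, w⟫_ℝ = 0 := by
    rintro w ⟨ρ, hρm, hw⟩
    rw [ae_weight_iff hF] at hw
    have hfg : (fun p => (f - g : KSpace F) p) =ᵐ[volume] fun p => f p - ψ p.1 * F p := by
      have h1 := Lp.coeFn_sub f g
      rw [ae_weight_iff hF] at h1
      filter_upwards [h1, hgae] with p hp hp'
      rw [hp, Pi.sub_apply, hp']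
    have hint : Integrable (fun p => ρ p.1 * (f p - ψ p.1 * F p)) (volume : Measure (Phase d)) := by
      have h1 : Integrable (fun p => w p * (f - g : KSpace F) p) (weight F) :=
        (Lp.memLp w).integrable_mul (Lp.memLp (f - g))
      rw [integrable_weight_iff hF] at h1
      refine h1.congr ?_
      filter_upwards [hw, hfg] with p h2 h3
      rw [h2, h3]
      have := (hF.pos p).ne'
      field_simp
    rw [L2.inner_def, integral_weight hF]
    have h4 : ∫ p, ⟪(f - g : KSpace F) p, w p⟫_ℝ / F p
        = ∫ p : Phase d, ρ p.1 * (f p - ψ p.1 * F p) := by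
      refine integral_congr_ae ?_
      filter_upwards [hw, hfg] with p h2 h3
      rw [h2, h3]
      have := (hF.pos p).ne'
      simp only [RCLike.inner_apply, conj_trivial]
      field_simp
    rw [h4]
    have h5 := integral_prod (μ := (volume : Measure (Pos d)))
      (ν := (volume : Measure (Pos d))) _ hint
    refine h5.trans ?_
    rw [← integral_zero (Pos d) ℝ]
    refine integral_congr_ae ?_
    filter_upwards [s1, s2, hρpos, hψ] with x h1 h2 h4 h5
    rw [integral_const_mul, integral_sub h1 (h2.const_mul _), integral_const_mul]
    have hψx : ψ x * (∫ v, F (x, v)) = ∫ v, f (x, v) := by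
      rw [← h5, hq]; field_simp
    rw [hψx]; ring
  have hP : localProj F f = g := by
    refine Submodule.eq_starProjection_of_mem_of_inner_eq_zero
      (Submodule.le_topologicalClosure _ hgmem) ?_
    have hsub : f - g ∈ (localEquilibria F).topologicalClosureᗮ := by
      rw [Submodule.orthogonal_closure]
      exact (Submodule.mem_orthogonal' _ _).2 horth
    exact (Submodule.mem_orthogonal' _ _).1 hsub
  rw [hP]
  filter_upwards [hgae, hψ2] with p h1 h2
  rw [h1, ← h2]

/-- Multiplication of `f` by the function `q` of the position variable; it is the product
whenever that lies in `L²(F⁻¹ dx dv)`, in particular for every bounded measurable `q`. -/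
def mulPos (F : Phase d → ℝ) (q : Pos d → ℝ) (f : KSpace F) : KSpace F :=
  open Classical in
  if h : MemLp (fun p : Phase d => q p.1 * f p) 2 (weight F) then h.toLp _ else 0

theorem mulPos_ae_eq (F : Phase d → ℝ) {q : Pos d → ℝ} (hq : Measurable q)
    {C : ℝ} (hC : ∀ x, |q x| ≤ C) (f : KSpace F) :
    mulPos F q f =ᵐ[weight F] fun p => q p.1 * f p := by
  have h : MemLp (fun p : Phase d => q p.1 * f p) 2 (weight F) := by
    refine (Lp.memLp f).of_le_mul (c := C)
      ((hq.comp measurable_fst).aestronglyMeasurable.mul (Lp.aestronglyMeasurable f)) ?_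
    refine Filter.Eventually.of_forall fun p => ?_
    rw [norm_mul]
    exact mul_le_mul_of_nonneg_right (hC p.1) (norm_nonneg _)
  rw [mulPos, dif_pos h]
  exact h.coeFn_toLp

/-- A deterministic collision operator: bounded and symmetric on `L²(F⁻¹ dx dv)`, acting on the
velocity variable only (it commutes with multiplication by bounded functions of `x`), and with
null space the local equilibria. -/
structure IsCollisionOperator (F : Phase d → ℝ) (L : KSpace F →L[ℝ] KSpace F) : Prop where
  symmetric : ∀ f g, ⟪L f, g⟫_ℝ = ⟪f, L g⟫_ℝ
  local_in_position : ∀ q : Pos d → ℝ, Measurable q → (∃ C, ∀ x, |q x| ≤ C) →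
    ∀ f, L (mulPos F q f) = mulPos F q (L f)
  null_space : ∀ f, L f = 0 ↔ f ∈ localEquilibria F

/-- A transport operator: densely defined, closed and skew symmetric on `L²(F⁻¹ dx dv)`, and
determined by its restriction to the `f ∈ D(T)` with `Π f ∈ D(T)`, where
`T f = T Π f + T (1 - Π) f` makes sense. -/
structure IsTransportOperator (F : Phase d → ℝ) (T : KSpace F →ₗ.[ℝ] KSpace F) : Prop where
  dense_domain : Dense (T.domain : Set (KSpace F))
  closed : T.IsClosed
  skew_symmetric : ∀ f g : T.domain, ⟪T f, (g : KSpace F)⟫_ℝ = -⟪(f : KSpace F), T g⟫_ℝ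
  core : T.HasCore (T.domain ⊓ T.domain.comap (localProj F).toLinearMap)

/-- `Null L ∩ Null T = Span {F}`. -/
def IsGlobalEquilibrium (F : Phase d → ℝ) (T : KSpace F →ₗ.[ℝ] KSpace F)
    (L : KSpace F →L[ℝ] KSpace F) : Prop :=
  ∀ f : KSpace F, (L f = 0 ∧ ∃ h : f ∈ T.domain, T ⟨f, h⟩ = 0) ↔
    ∃ c : ℝ, f =ᵐ[weight F] fun p => c * F p

/-- The random collision operator `L_z f = σ(x, z) L f`. -/
def randomCollision {Z : Type*} (F : Phase d → ℝ) (L : KSpace F →L[ℝ] KSpace F)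
    (σ : Pos d → Z → ℝ) (z : Z) (f : KSpace F) : KSpace F :=
  mulPos F (fun x => σ x z) (L f)

/-- The auxiliary operator `A = (1 + (TΠ)* (TΠ))⁻¹ (TΠ)*`. -/
def auxA (F : Phase d → ℝ) (T : KSpace F →ₗ.[ℝ] KSpace F) : KSpace F →L[ℝ] KSpace F :=
  auxOperator (compBounded T (localProj F))

/-- The hypocoercivity assumptions on the transport operator `T` and the (everywhere defined)
collision operator `Lz`, with constants `α`, `β`, `γ`. Macroscopic coercivity is required for
functions of zero mass (it fails for the global equilibrium `F`). -/
structure Hypocoercive (F : Phase d → ℝ) (T : KSpace F →ₗ.[ℝ] KSpace F)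
    (Lz : KSpace F → KSpace F) (α β γ : ℝ) : Prop where
  symmetric : ∀ f g, ⟪Lz f, g⟫_ℝ = ⟪f, Lz g⟫_ℝ
  microscopic : ∀ f, α * ‖f - localProj F f‖ ^ 2 ≤ -⟪Lz f, f⟫_ℝ
  macroscopic : ∀ f, mass F f = 0 → ∀ h : localProj F f ∈ T.domain,
    β * ‖localProj F f‖ ^ 2 ≤ ‖T ⟨localProj F f, h⟩‖ ^ 2
  orthogonality : ∀ f, ∀ h : localProj F f ∈ T.domain, localProj F (T ⟨localProj F f, h⟩) = 0
  auxiliary : ∀ f, ∀ h : f - localProj F f ∈ T.domain,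
    ‖auxA F T (T ⟨f - localProj F f, h⟩)‖ + ‖auxA F T (Lz f)‖ ≤ γ * ‖f - localProj F f‖

/-- `u` is the (mild) solution on `[0, ∞)` of `∂ₜ u + T u = Lz u`, `u(0) = u₀`: it is continuous
with values in `L²(F⁻¹ dx dv)`, its time integrals lie in `D(T)`, and
`u(t) = u₀ - T ∫₀ᵗ u ds + Lz ∫₀ᵗ u ds`. -/
def IsMildSolution (F : Phase d → ℝ) (T : KSpace F →ₗ.[ℝ] KSpace F)
    (Lz : KSpace F → KSpace F) (u₀ : KSpace F) (u : ℝ → KSpace F) : Prop :=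
  ContinuousOn u (Ici 0) ∧ ∀ t : ℝ, 0 ≤ t → ∃ h : (∫ s in (0 : ℝ)..t, u s) ∈ T.domain,
    u t = u₀ - T ⟨∫ s in (0 : ℝ)..t, u s, h⟩ + Lz (∫ s in (0 : ℝ)..t, u s)

/-- The Taylor series `∑ₗ D^l u(z₀) / l!` of `u : Ω → E` at `z₀`. -/
def taylorSeriesWithin {Z E : Type*} [NormedAddCommGroup Z] [NormedSpace ℝ Z]
    [NormedAddCommGroup E] [NormedSpace ℝ E] (u : Z → E) (Ω : Set Z) (z₀ : Z) :
    FormalMultilinearSeries ℝ Z E :=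
  fun l => ((l.factorial : ℝ)⁻¹) • iteratedFDerivWithin ℝ l u Ω z₀

end Kinetic

end

open Kinetic

/-!
The solution `f(t, z)` is compared, near a parameter `z₀`, with the equation frozen at `z₀`: it
solves `∂ₜ f + T f = L_{z₀} f + S` with forcing term `S = (L_z - L_{z₀}) f`. Suppose that, on
functions of zero mass, this equation has an energy form `⟪G w, w⟫`, comparable to `‖w‖²`, with
`d/dt ⟪G w, w⟫ ≤ 2 η ⟪G w, w⟫ - a ‖w‖² + C ‖S‖²` (`IsEnergyForm`). Then the trajectory
`t ↦ exp (-η t) w(t)` in `L²(0, ∞)` and the value `exp (-η t) w(t)` at each time are bounded by the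
initial datum and `exp (-η t) S` in `L²(0, ∞)`. The operator `T` is only skew symmetric and
need not generate a semigroup, so that not all data admit a solution; but the bound extends the
solution map from the data that do, by orthogonal projection, to a bounded linear map on all data
(`exists_continuousLinearMap_comp_eq`, `exists_solutionMap`). The trajectory `u(z)` of `f(·, z)`
therefore satisfies a linear equation `u(z) = g(z) + M(z) u(z)` with `g` and `M` smooth and
`M(z₀) = 0`. Inverting `1 - M(z)` gives smoothness in `z`, and since the derivative of `u` of order
`l` drops out of the right-hand side at `z₀`, the Leibniz rule gives a recursion which bounds the
`l`-th derivative of `f(t, ·)` by `l! K (1 + √(C / a) m) ^ l`, where `m` is `‖L‖` times a bound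
for the `k`-th derivatives of `σ` divided by `k!`
(`contDiffOn_and_norm_iteratedFDerivWithin_le`). The smoothness of `z ↦ L_z` in the operator norm
that this requires follows from the bounds on the derivatives of `σ`, which are uniform in `x`
(`contDiffOn_mulOp_comp`).

Two energy forms give the two claims. The norm itself, with growth rate and dissipation
`η = a = μ` for arbitrarily large `μ` (`isEnergyForm_id`), makes `√(C / a) m ≤ 1`; the `l`-th
derivatives are then at most `l! K 2 ^ l`, with `K` depending on `t`, and Taylor's theorem gives
convergence with radius `1 / 2`, hence also `1 / (2 (1 + H))`
(`hasFPowerSeriesWithinOnBall_taylorSeriesWithin`). Hypocoercivity provides a form with `η < 0`,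
the modified entropy `‖w‖² + 2 ε ⟪A w, w⟫` (`IsMacroscopic.exists_isEnergyForm`), and thereby the
exponential decay of all derivatives.
-/

noncomputable section

namespace Kinetic

/-! ### Taylor expansion and derivatives within a convex set -/

section Taylor
variable {Z E : Type*} [NormedAddCommGroup Z] [NormedSpace ℝ Z]
  [NormedAddCommGroup E] [NormedSpace ℝ E]

theorem hasDerivWithinAt_iteratedFDerivWithin_lineMap {Ω : Set Z} (hΩ : Convex ℝ Ω)
    (hu : UniqueDiffOn ℝ Ω) {g : Z → E} (hg : ContDiffOn ℝ ∞ g Ω) {z₀ h : Z} (hz : z₀ ∈ Ω)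
    (hzh : z₀ + h ∈ Ω) (l : ℕ) {s : ℝ} (hs : s ∈ Icc (0 : ℝ) 1) :
    HasDerivWithinAt (fun s : ℝ => iteratedFDerivWithin ℝ l g Ω (z₀ + s • h) fun _ => h)
      (iteratedFDerivWithin ℝ (l + 1) g Ω (z₀ + s • h) fun _ => h) (Icc 0 1) s := by
  have hmaps : MapsTo (fun s : ℝ => z₀ + s • h) (Icc 0 1) Ω := fun s hs =>
    hΩ.add_smul_mem hz hzh hs
  have h1 : HasFDerivWithinAt (iteratedFDerivWithin ℝ l g Ω)
      (fderivWithin ℝ (iteratedFDerivWithin ℝ l g Ω) Ω (z₀ + s • h)) Ω (z₀ + s • h) :=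
    (hg.differentiableOn_iteratedFDerivWithin (by exact_mod_cast WithTop.coe_lt_top _) hu _
      (hmaps hs)).hasFDerivWithinAt
  have h2 : HasDerivWithinAt (fun s : ℝ => z₀ + s • h) h (Icc 0 1) s := by
    simpa using ((hasDerivWithinAt_id s (Icc 0 1)).smul_const h).const_add z₀
  have h3 := h1.comp_hasDerivWithinAt s h2 hmaps
  have h4 := (ContinuousMultilinearMap.apply ℝ (fun _ : Fin l => Z) E
    (fun _ => h)).hasFDerivAt.comp_hasDerivWithinAt s h3
  have h5 : (iteratedFDerivWithin ℝ (l + 1) g Ω (z₀ + s • h) fun _ => h)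
      = ContinuousMultilinearMap.apply ℝ (fun _ : Fin l => Z) E (fun _ => h)
        (fderivWithin ℝ (iteratedFDerivWithin ℝ l g Ω) Ω (z₀ + s • h) h) := by
    rw [iteratedFDerivWithin_succ_apply_left]; rfl
  rw [h5]
  exact h4

/-- Taylor's theorem within a convex set, with a bound on the remainder. -/
theorem norm_sub_sum_iteratedFDerivWithin_le {Ω : Set Z} (hΩ : Convex ℝ Ω)
    (hu : UniqueDiffOn ℝ Ω) {g : Z → E} (hg : ContDiffOn ℝ ∞ g Ω) {z₀ h : Z} (hz : z₀ ∈ Ω)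
    (hzh : z₀ + h ∈ Ω) (n : ℕ) {C : ℝ}
    (hC : ∀ z ∈ Ω, ‖iteratedFDerivWithin ℝ (n + 1) g Ω z‖ ≤ C) :
    ‖g (z₀ + h) - ∑ l ∈ Finset.range (n + 1),
      ((l.factorial : ℝ)⁻¹ • iteratedFDerivWithin ℝ l g Ω z₀ fun _ => h)‖
      ≤ C * ‖h‖ ^ (n + 1) / n.factorial := by
  have hmaps : MapsTo (fun s : ℝ => z₀ + s • h) (Icc 0 1) Ω := fun s hs =>
    hΩ.add_smul_mem hz hzh hs
  set φ : ℝ → E := fun s => g (z₀ + s • h) with hφ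
  have hφc : ContDiffOn ℝ ∞ φ (Icc 0 1) :=
    hg.comp (contDiff_const.add (contDiff_id.smul contDiff_const)).contDiffOn hmaps
  have hder : ∀ l : ℕ, ∀ s ∈ Icc (0 : ℝ) 1, iteratedDerivWithin l φ (Icc 0 1) s
      = iteratedFDerivWithin ℝ l g Ω (z₀ + s • h) fun _ => h := by
    intro l
    induction l with
    | zero => intro s _; simp [hφ]
    | succ l ih =>
      intro s hs
      rw [iteratedDerivWithin_succ, derivWithin_congr ih (ih s hs)]
      exact (hasDerivWithinAt_iteratedFDerivWithin_lineMap hΩ hu hg hz hzh l hs).derivWithin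
        (uniqueDiffOn_Icc_zero_one s hs)
  have key := taylor_mean_remainder_bound (f := φ) (a := 0) (b := 1) (x := 1) (n := n)
    (C := C * ‖h‖ ^ (n + 1)) zero_le_one (hφc.of_le (by exact_mod_cast le_top))
    (right_mem_Icc.2 zero_le_one) (fun y hy => by
      rw [hder _ y hy]
      refine (ContinuousMultilinearMap.le_opNorm _ _).trans ?_
      simp only [Finset.prod_const, Finset.card_univ, Fintype.card_fin]
      exact mul_le_mul_of_nonneg_right (hC _ (hmaps hy)) (by positivity))
  simp only [sub_zero, one_pow, mul_one] at key
  rw [taylor_within_apply] at key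
  have e1 : φ 1 = g (z₀ + h) := by simp [hφ]
  rw [e1] at key
  convert key using 3
  refine Finset.sum_congr rfl fun l _ => ?_
  rw [hder l 0 (left_mem_Icc.2 zero_le_one)]
  simp

/-- A smooth function on a convex set whose `l`-th derivatives are at most `l! C ρ ^ l` is the sum
of its Taylor series on every ball of radius at most `1 / ρ`. -/
theorem hasFPowerSeriesWithinOnBall_taylorSeriesWithin [CompleteSpace E] {Ω : Set Z}
    (hΩ : Convex ℝ Ω)
    (hu : UniqueDiffOn ℝ Ω) {g : Z → E} (hg : ContDiffOn ℝ ∞ g Ω) {z₀ : Z} (hz : z₀ ∈ Ω)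
    {C ρ r : ℝ} (hC : ∀ l : ℕ, ∀ z ∈ Ω, ‖iteratedFDerivWithin ℝ l g Ω z‖
      ≤ l.factorial * (C * ρ ^ l)) (hρ : 0 < ρ) (hr : 0 < r) (hρr : ρ * r ≤ 1) :
    HasFPowerSeriesWithinOnBall g (taylorSeriesWithin g Ω z₀) Ω z₀ (ENNReal.ofReal r) := by
  have hC0 : 0 ≤ C := by
    have := (norm_nonneg _).trans (hC 0 z₀ hz)
    simpa using this
  have hbd : ∀ l : ℕ, ‖taylorSeriesWithin g Ω z₀ l‖ ≤ C * ρ ^ l := by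
    intro l
    rw [taylorSeriesWithin, norm_smul, norm_inv, Real.norm_natCast]
    rw [inv_mul_le_iff₀ (by positivity)]
    exact hC l z₀ hz
  refine ⟨?_, by simpa using hr, ?_⟩
  · refine FormalMultilinearSeries.le_radius_of_bound _ C (r := r.toNNReal) fun n => ?_
    rw [Real.coe_toNNReal _ hr.le]
    calc _ ≤ C * ρ ^ n * r ^ n := by gcongr; exact hbd n
      _ = C * (ρ * r) ^ n := by rw [mul_pow]; ring
      _ ≤ C * 1 := by gcongr; exact pow_le_one₀ (by positivity) hρr
      _ = C := mul_one C
  · intro h hmem hball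
    rw [insert_eq_of_mem hz] at hmem
    have hh : ‖h‖ < r := by
      rw [Metric.mem_eball, edist_zero_right, ← ofReal_norm] at hball
      exact (ENNReal.ofReal_lt_ofReal_iff hr).1 hball
    have hq : ρ * ‖h‖ < 1 := lt_of_lt_of_le (mul_lt_mul_of_pos_left hh hρ) hρr
    have hq0 : 0 ≤ ρ * ‖h‖ := by positivity
    have hterm : ∀ l : ℕ, ‖taylorSeriesWithin g Ω z₀ l fun _ => h‖ ≤ C * (ρ * ‖h‖) ^ l := by
      intro l
      refine (ContinuousMultilinearMap.le_opNorm _ _).trans ?_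
      simp only [Finset.prod_const, Finset.card_univ, Fintype.card_fin]
      rw [mul_pow, ← mul_assoc]
      exact mul_le_mul_of_nonneg_right (hbd l) (by positivity)
    have hsum : Summable fun l : ℕ => taylorSeriesWithin g Ω z₀ l fun _ => h :=
      Summable.of_norm_bounded ((summable_geometric_of_lt_one hq0 hq).mul_left C) hterm
    have hlim : Filter.Tendsto (fun n : ℕ => ∑ l ∈ Finset.range (n + 1),
        taylorSeriesWithin g Ω z₀ l fun _ => h) Filter.atTop (nhds (g (z₀ + h))) := by
      rw [tendsto_iff_norm_sub_tendsto_zero]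
      have hsq : Filter.Tendsto (fun n : ℕ => C * (((n + 1 : ℕ) : ℝ) * (ρ * ‖h‖) ^ (n + 1)))
          Filter.atTop (nhds 0) := by
        have := (tendsto_self_mul_const_pow_of_lt_one hq0 hq).comp (Filter.tendsto_add_atTop_nat 1)
        simpa using this.const_mul C
      refine squeeze_zero (fun _ => norm_nonneg _) (fun n => ?_) hsq
      rw [norm_sub_rev]
      refine (norm_sub_sum_iteratedFDerivWithin_le hΩ hu hg hz hmem n (hC (n + 1))).trans ?_
      rw [Nat.factorial_succ, div_le_iff₀ (by positivity)]
      push_cast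
      rw [mul_pow]
      exact le_of_eq (by ring)
    have h1 := hsum.hasSum
    have h2 := h1.tendsto_sum_nat.comp (Filter.tendsto_add_atTop_nat 1)
    rwa [tendsto_nhds_unique h2 hlim] at h1

end Taylor

section Implicit
variable {Z W W' : Type*} [NormedAddCommGroup Z] [NormedSpace ℝ Z]
  [NormedAddCommGroup W] [NormedSpace ℝ W] [NormedAddCommGroup W'] [NormedSpace ℝ W']

/-- The solution of the linear equation `u = g + M u` is as smooth as `g` and `M` near a point
where `M` vanishes. -/
theorem contDiffWithinAt_of_eq_add_apply [CompleteSpace W] {Ω : Set Z} {z₀ : Z} (hz : z₀ ∈ Ω)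
    {u g : Z → W} {M : Z → W →L[ℝ] W} (hM0 : M z₀ = 0) (hM : ContDiffWithinAt ℝ ∞ M Ω z₀)
    (hg : ContDiffWithinAt ℝ ∞ g Ω z₀) (hu : ∀ z ∈ Ω, u z = g z + M z (u z)) :
    ContDiffWithinAt ℝ ∞ u Ω z₀ := by
  have h1 : ContDiffWithinAt ℝ ∞ (fun z => (1 : W →L[ℝ] W) - M z) Ω z₀ :=
    contDiffWithinAt_const.sub hM
  have h2 : ContDiffWithinAt ℝ ∞ (fun z => Ring.inverse ((1 : W →L[ℝ] W) - M z)) Ω z₀ := by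
    have h := contDiffAt_ringInverse (n := ∞) ℝ (1 : (W →L[ℝ] W)ˣ)
    have h' : ContDiffAt ℝ ∞ Ring.inverse ((1 : W →L[ℝ] W) - M z₀) := by
      rw [hM0, sub_zero]; exact h
    exact h'.comp_contDiffWithinAt z₀ h1
  refine (h2.clm_apply hg).congr_of_eventuallyEq ?_ ?_
  · have hopen : ∀ᶠ x in nhds ((1 : W →L[ℝ] W) - M z₀), IsUnit x := by
      rw [hM0, sub_zero]; exact Units.isOpen.mem_nhds isUnit_one
    filter_upwards [h1.continuousWithinAt.eventually hopen, self_mem_nhdsWithin] with z hz1 hz2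
    have h3 : g z = ((1 : W →L[ℝ] W) - M z) (u z) := by
      rw [sub_apply, one_apply_eq_self]
      exact (sub_eq_of_eq_add (hu z hz2)).symm
    rw [h3, ← mul_apply_eq_comp, Ring.inverse_mul_cancel _ hz1,
      one_apply_eq_self]
  · rw [hM0, sub_zero, Ring.inverse_one, one_apply_eq_self, hu z₀ hz, hM0]
    simp

/-- Leibniz estimate at a point where the operator `N` vanishes: only the derivatives of `u` of
order less than `l` enter. -/
theorem norm_iteratedFDerivWithin_add_apply_le {Ω : Set Z} (hΩ : UniqueDiffOn ℝ Ω) {z₀ : Z}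
    (hz : z₀ ∈ Ω) {u : Z → W} {v g : Z → W'} {N : Z → W →L[ℝ] W'} (hN0 : N z₀ = 0)
    (hN : ContDiffOn ℝ ∞ N Ω) (hg : ContDiffOn ℝ ∞ g Ω) (hu : ContDiffOn ℝ ∞ u Ω)
    (hv : ∀ z ∈ Ω, v z = g z + N z (u z)) {c m Y ρ : ℝ} {l : ℕ}
    (hc : ‖iteratedFDerivWithin ℝ l g Ω z₀‖ ≤ l.factorial * c)
    (hm : ∀ k : ℕ, 0 < k → ‖iteratedFDerivWithin ℝ k N Ω z₀‖ ≤ k.factorial * m)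
    (hY : ∀ j < l, ‖iteratedFDerivWithin ℝ j u Ω z₀‖ ≤ j.factorial * (Y * ρ ^ j)) :
    ‖iteratedFDerivWithin ℝ l v Ω z₀‖
      ≤ l.factorial * (c + m * (Y * ∑ j ∈ Finset.range l, ρ ^ j)) := by
  have hNu : ContDiffOn ℝ ∞ (fun z => N z (u z)) Ω := hN.clm_apply hu
  rw [iteratedFDerivWithin_congr hv hz]
  have hadd : iteratedFDerivWithin ℝ l (fun z => g z + N z (u z)) Ω z₀
      = iteratedFDerivWithin ℝ l g Ω z₀ + iteratedFDerivWithin ℝ l (fun z => N z (u z)) Ω z₀ :=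
    fun_iteratedFDerivWithin_add_apply ((hg z₀ hz).of_le (by exact_mod_cast le_top))
      ((hNu z₀ hz).of_le (by exact_mod_cast le_top)) hΩ hz
  have hleib : ‖iteratedFDerivWithin ℝ l (fun z => N z (u z)) Ω z₀‖
      ≤ ∑ j ∈ Finset.range (l + 1), (l.choose j : ℝ) * ‖iteratedFDerivWithin ℝ j u Ω z₀‖
        * ‖iteratedFDerivWithin ℝ (l - j) N Ω z₀‖ :=
    ContinuousLinearMap.norm_iteratedFDerivWithin_le_of_bilinear_of_le_one
      (ContinuousLinearMap.apply ℝ W' : W →L[ℝ] (W →L[ℝ] W') →L[ℝ] W')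
      hu hN hΩ hz (by exact_mod_cast le_top) (by
        refine ContinuousLinearMap.opNorm_le_bound _ zero_le_one fun w => ?_
        rw [one_mul]
        refine ContinuousLinearMap.opNorm_le_bound _ (norm_nonneg _) fun A => ?_
        exact (A.le_opNorm w).trans_eq (mul_comm _ _))
  rw [hadd]
  refine (norm_add_le _ _).trans ?_
  rw [mul_add]
  refine add_le_add hc (hleib.trans ?_)
  rw [Finset.sum_range_succ]
  have hlast : ‖iteratedFDerivWithin ℝ (l - l) N Ω z₀‖ = 0 := by
    rw [Nat.sub_self, norm_iteratedFDerivWithin_zero, hN0, norm_zero]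
  rw [hlast, mul_zero, add_zero, Finset.mul_sum, Finset.mul_sum, Finset.mul_sum]
  refine Finset.sum_le_sum fun j hj => ?_
  have hjl : j < l := Finset.mem_range.1 hj
  have hch : (l.choose j : ℝ) * j.factorial * (l - j).factorial = l.factorial := by
    exact_mod_cast Nat.choose_mul_factorial_mul_factorial hjl.le
  calc (l.choose j : ℝ) * ‖iteratedFDerivWithin ℝ j u Ω z₀‖
        * ‖iteratedFDerivWithin ℝ (l - j) N Ω z₀‖
      ≤ (l.choose j : ℝ) * (j.factorial * (Y * ρ ^ j)) * ((l - j).factorial * m) := by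
        have hYj := hY j hjl
        have hmj := hm (l - j) (by omega)
        have : 0 ≤ (j.factorial : ℝ) * (Y * ρ ^ j) := (norm_nonneg _).trans hYj
        gcongr
    _ = ((l.choose j : ℝ) * j.factorial * (l - j).factorial) * (m * (Y * ρ ^ j)) := by ring
    _ = _ := by rw [hch]

end Implicit

/-! ### Extension of bounded maps from a subspace of data -/

/-- A linear map `j`, bounded relative to a linear map `i` into a Hilbert space, factors through
`i`: no closed complement has to be given, the orthogonal projection onto the closure of the range
of `i` supplies it. -/
theorem exists_continuousLinearMap_comp_eq {P E G : Type*} [AddCommGroup P] [Module ℝ P]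
    [NormedAddCommGroup E] [InnerProductSpace ℝ E] [CompleteSpace E]
    [NormedAddCommGroup G] [NormedSpace ℝ G] [CompleteSpace G]
    (i : P →ₗ[ℝ] E) (j : P →ₗ[ℝ] G) {C : ℝ} (hC : 0 ≤ C) (h : ∀ p, ‖j p‖ ≤ C * ‖i p‖) :
    ∃ K : E →L[ℝ] G, (∀ p, K (i p) = j p) ∧ ‖K‖ ≤ C := by
  set S := (LinearMap.range i).topologicalClosure with hS
  have hmem : ∀ p, i p ∈ S := fun p =>
    Submodule.le_topologicalClosure _ (LinearMap.mem_range_self i p)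
  set e : P →ₗ[ℝ] S := i.codRestrict S hmem with he
  have hdense : DenseRange e := by
    intro x
    have hx : (x : E) ∈ closure (LinearMap.range i : Set E) := by
      rw [← Submodule.topologicalClosure_coe]; exact x.2
    rw [closure_subtype]
    refine closure_mono ?_ hx
    rintro _ ⟨p, rfl⟩
    exact ⟨e p, ⟨p, rfl⟩, rfl⟩
  have hb : ∀ p, ‖j p‖ ≤ C * ‖e p‖ := fun p => h p
  refine ⟨(j.extendOfNorm e) ∘L S.orthogonalProjectionOnto, fun p => ?_, ?_⟩
  · have h1 : S.orthogonalProjectionOnto (i p) = e p :=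
      Submodule.orthogonalProjectionOnto_mem_subspace_eq_self (K := S) (e p)
    rw [ContinuousLinearMap.comp_apply, h1, LinearMap.extendOfNorm_eq hdense ⟨C, hb⟩]
  · refine (ContinuousLinearMap.opNorm_comp_le _ _).trans ?_
    calc _ ≤ C * 1 := mul_le_mul (LinearMap.opNorm_extendOfNorm_le hdense hC hb)
          (Submodule.orthogonalProjectionOnto_norm_le S)
          (norm_nonneg (S.orthogonalProjectionOnto)) hC
      _ = C := mul_one C

/-! ### Energy estimates for forced mild solutions -/

section Energy
variable {H : Type*} [NormedAddCommGroup H] [InnerProductSpace ℝ H]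

/-- `w` is a mild solution on `[0, ∞)` of `∂ₜ w + T w = B w + S`, `w(0) = w₀`, with a continuous
forcing term `S`. -/
structure IsForcedMildSolution (T : H →ₗ.[ℝ] H) (B : H →L[ℝ] H) (w₀ : H) (S w : ℝ → H) :
    Prop where
  continuousOn_forcing : ContinuousOn S (Ici 0)
  continuousOn : ContinuousOn w (Ici 0)
  mild : ∀ t : ℝ, 0 ≤ t → ∃ h : (∫ s in (0 : ℝ)..t, w s) ∈ T.domain,
    w t = w₀ - T ⟨∫ s in (0 : ℝ)..t, w s, h⟩ + B (∫ s in (0 : ℝ)..t, w s)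
      + ∫ s in (0 : ℝ)..t, S s

/-- The quadratic form `⟪G w, w⟫`, equivalent to the square of the norm, obeys an energy
inequality along `∂ₜ w + T w = B w + S` as long as `w` and `S` are orthogonal to `e`:
`d/dt ⟪G w, w⟫ ≤ 2 η ⟪G w, w⟫ - a ‖w‖² + C ‖S‖²`. Negative `η` is decay. -/
structure IsEnergyForm (T : H →ₗ.[ℝ] H) (e : H) (B G : H →L[ℝ] H) (η a C : ℝ) : Prop where
  symmetric : ∀ x y, ⟪G x, y⟫_ℝ = ⟪x, G y⟫_ℝ
  lower : ∀ x, 1 / 2 * ‖x‖ ^ 2 ≤ ⟪G x, x⟫_ℝ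
  upper : ∀ x, ⟪G x, x⟫_ℝ ≤ 2 * ‖x‖ ^ 2
  dissipation : ∀ (x : T.domain) (s : H), ⟪(x : H), e⟫_ℝ = 0 → ⟪s, e⟫_ℝ = 0 →
    2 * ⟪G x, -T x + B x + s⟫_ℝ - 2 * η * ⟪G x, x⟫_ℝ ≤ -a * ‖(x : H)‖ ^ 2 + C * ‖s‖ ^ 2

variable {T : H →ₗ.[ℝ] H} {e : H} {B G : H →L[ℝ] H} {η a C : ℝ} {w₀ : H} {S w : ℝ → H}

/-- The average of `w` over `[s, s + h]`; it makes sense, and is continuous, also at `h = 0`. -/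
def steklov (w : ℝ → H) (h s : ℝ) : H := ∫ θ in (0 : ℝ)..1, w (s + h * θ)

theorem continuous_steklov (hw : Continuous w) :
    Continuous fun p : ℝ × ℝ => steklov w p.1 p.2 := by
  unfold steklov
  apply intervalIntegral.continuous_parametric_intervalIntegral_of_continuous'
  fun_prop

theorem IsForcedMildSolution.apply_zero (hw : IsForcedMildSolution T B w₀ S w) : w 0 = w₀ := by
  obtain ⟨h, h1⟩ := hw.mild 0 le_rfl
  have h2 : T ⟨∫ s in (0 : ℝ)..0, w s, h⟩ = 0 := by
    have : (⟨∫ s in (0 : ℝ)..0, w s, h⟩ : T.domain) = 0 :=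
      Subtype.ext intervalIntegral.integral_same
    rw [this, LinearPMap.map_zero]
  rw [h2] at h1
  simpa using h1

theorem steklov_eq (hw : Continuous w) {h : ℝ} (hh : h ≠ 0) (s : ℝ) :
    steklov w h s = h⁻¹ • ((∫ r in (0 : ℝ)..(s + h), w r) - ∫ r in (0 : ℝ)..s, w r) := by
  rw [steklov, intervalIntegral.integral_comp_add_mul w hh s, mul_zero, add_zero, mul_one,
    intervalIntegral.integral_interval_sub_left (hw.intervalIntegrable _ _)
      (hw.intervalIntegrable _ _)]

/-- Averages of a mild solution are classical solutions. -/
theorem IsForcedMildSolution.steklov_mem (hw : IsForcedMildSolution T B w₀ S w)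
    (hwc : Continuous w) (hSc : Continuous S) {h : ℝ} (hh : 0 < h) {s : ℝ} (hs : 0 ≤ s) :
    ∃ hm : steklov w h s ∈ T.domain,
      h⁻¹ • (w (s + h) - w s) = -T ⟨steklov w h s, hm⟩ + B (steklov w h s) + steklov S h s := by
  obtain ⟨m1, e1⟩ := hw.mild s hs
  obtain ⟨m2, e2⟩ := hw.mild (s + h) (by linarith)
  have hst := steklov_eq hwc hh.ne' s
  have hm : steklov w h s ∈ T.domain := by
    rw [hst]; exact T.domain.smul_mem _ (T.domain.sub_mem m2 m1)
  refine ⟨hm, ?_⟩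
  have hT : T ⟨steklov w h s, hm⟩ = h⁻¹ • (T ⟨_, m2⟩ - T ⟨_, m1⟩) := by
    rw [← LinearPMap.map_sub, ← LinearPMap.map_smul]
    congr 1
    exact Subtype.ext hst
  rw [hT, hst, steklov_eq hSc hh.ne' s, e1, e2, ContinuousLinearMap.map_smul,
    ContinuousLinearMap.map_sub]
  module

variable [CompleteSpace H]

theorem steklov_zero (s : ℝ) : steklov w 0 s = w s := by
  simp [steklov]

theorem hasDerivAt_steklov (hw : Continuous w) {h : ℝ} (hh : h ≠ 0) (s : ℝ) :
    HasDerivAt (steklov w h) (h⁻¹ • (w (s + h) - w s)) s := by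
  have h1 : HasDerivAt (fun s => ∫ r in (0 : ℝ)..(s + h), w r) (w (s + h)) s :=
    (hw.integral_hasStrictDerivAt 0 (s + h)).hasDerivAt.comp_add_const s h
  have h2 : HasDerivAt (fun s => ∫ r in (0 : ℝ)..s, w r) (w s) s :=
    (hw.integral_hasStrictDerivAt 0 s).hasDerivAt
  have h3 := (h1.sub h2).const_smul h⁻¹
  have h4 : steklov w h = h⁻¹ • ((fun s => ∫ r in (0 : ℝ)..(s + h), w r)
      - fun s => ∫ r in (0 : ℝ)..s, w r) := by
    funext s; exact steklov_eq hw hh s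
  rw [h4]
  exact h3

theorem steklov_inner_eq_zero (hw : ∀ t, ⟪w t, e⟫_ℝ = 0) (hwc : Continuous w) (h s : ℝ) :
    ⟪steklov w h s, e⟫_ℝ = 0 := by
  have h1 := (innerSL ℝ e).intervalIntegral_comp_comm (μ := volume) (a := 0) (b := 1)
    (f := fun θ => w (s + h * θ)) (by
      apply Continuous.intervalIntegrable; fun_prop)
  rw [real_inner_comm, ← innerSL_apply_apply ℝ, steklov, ← h1]
  have h2 : ∀ t, (innerSL ℝ e) (w t) = 0 := fun t => by
    rw [innerSL_apply_apply, real_inner_comm]; exact hw t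
  simp [h2]

/-- The energy inequality, for solutions extended continuously to all times. The averages of `w`
are differentiable in time, with values in `D(T)`, and satisfy it; the averaging length then
tends to zero. -/
theorem IsForcedMildSolution.energy_of_continuous (hE : IsEnergyForm T e B G η a C)
    (hw : IsForcedMildSolution T B w₀ S w) (hwc : Continuous w) (hSc : Continuous S)
    (hwe : ∀ t, ⟪w t, e⟫_ℝ = 0) (hSe : ∀ t, ⟪S t, e⟫_ℝ = 0) {t : ℝ} (ht : 0 ≤ t) :
    Real.exp (-2 * η * t) * ⟪G (w t), w t⟫_ℝ
      + ∫ s in (0 : ℝ)..t, Real.exp (-2 * η * s) * (a * ‖w s‖ ^ 2 - C * ‖S s‖ ^ 2)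
      ≤ ⟪G w₀, w₀⟫_ℝ := by
  have cw := continuous_steklov hwc
  have cS := continuous_steklov hSc
  set Ψ : ℝ → ℝ → ℝ := fun h t =>
    Real.exp (-2 * η * t) * ⟪G (steklov w h t), steklov w h t⟫_ℝ
      + ∫ s in (0 : ℝ)..t, Real.exp (-2 * η * s)
        * (a * ‖steklov w h s‖ ^ 2 - C * ‖steklov S h s‖ ^ 2) with hΨ
  have key : ∀ h : ℝ, 0 < h → Ψ h t ≤ Ψ h 0 := by
    intro h hh
    have cwh : Continuous (steklov w h) := cw.comp (Continuous.prodMk_right h)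
    have cSh : Continuous (steklov S h) := cS.comp (Continuous.prodMk_right h)
    have hder : ∀ s, HasDerivAt (Ψ h)
        ((Real.exp (-2 * η * s) * (-2 * η)) * ⟪G (steklov w h s), steklov w h s⟫_ℝ
          + Real.exp (-2 * η * s) * (⟪G (steklov w h s), h⁻¹ • (w (s + h) - w s)⟫_ℝ
            + ⟪G (h⁻¹ • (w (s + h) - w s)), steklov w h s⟫_ℝ)
          + Real.exp (-2 * η * s)
            * (a * ‖steklov w h s‖ ^ 2 - C * ‖steklov S h s‖ ^ 2)) s := by
      intro s
      have d1 := hasDerivAt_steklov hwc hh.ne' s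
      have d2 := G.hasFDerivAt.comp_hasDerivAt s d1
      have d3 := HasDerivAt.inner ℝ d2 d1
      have d4 : HasDerivAt (fun s => Real.exp (-2 * η * s))
          (Real.exp (-2 * η * s) * (-2 * η)) s := by
        simpa using ((hasDerivAt_id s).const_mul (-2 * η)).exp
      have d5 : HasDerivAt (fun t => ∫ s in (0 : ℝ)..t, Real.exp (-2 * η * s)
          * (a * ‖steklov w h s‖ ^ 2 - C * ‖steklov S h s‖ ^ 2)) _ s :=
        (Continuous.integral_hasStrictDerivAt (by fun_prop) 0 s).hasDerivAt
      exact (d4.mul d3).add d5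
    refine (antitoneOn_of_deriv_nonpos (convex_Ici (0 : ℝ))
      (fun s _ => (hder s).continuousAt.continuousWithinAt)
      (fun s _ => (hder s).differentiableAt.differentiableWithinAt) (fun s hs => ?_))
      (self_mem_Ici) ht ht
    rw [interior_Ici, mem_Ioi] at hs
    rw [(hder s).deriv]
    obtain ⟨hm, he⟩ := hw.steklov_mem hwc hSc hh hs.le
    have hd := hE.dissipation ⟨_, hm⟩ (steklov S h s) (steklov_inner_eq_zero hwe hwc h s)
      (steklov_inner_eq_zero hSe hSc h s)
    simp only at hd
    rw [← he] at hd
    have hsym : ⟪G (h⁻¹ • (w (s + h) - w s)), steklov w h s⟫_ℝ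
        = ⟪G (steklov w h s), h⁻¹ • (w (s + h) - w s)⟫_ℝ := by
      rw [hE.symmetric, real_inner_comm]
    rw [hsym]
    have := Real.exp_pos (-2 * η * s)
    nlinarith
  -- both sides are continuous in the averaging length `h`, up to `h = 0`
  have hc : ∀ t, Continuous fun h => Ψ h t := by
    intro t
    have c1 : Continuous fun h => steklov w h t := cw.comp (Continuous.prodMk_left t)
    refine Continuous.add ?_ ?_
    · fun_prop
    · apply intervalIntegral.continuous_parametric_intervalIntegral_of_continuous'
      have : Continuous fun p : ℝ × ℝ => steklov w p.1 p.2 := cw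
      have : Continuous fun p : ℝ × ℝ => steklov S p.1 p.2 := cS
      simp only [Function.uncurry_def]
      fun_prop
  have hlim : Ψ 0 t ≤ Ψ 0 0 := by
    have hcl : IsClosed {h : ℝ | Ψ h t ≤ Ψ h 0} := isClosed_le (hc t) (hc 0)
    have hsub : closure (Ioi (0 : ℝ)) ⊆ {h : ℝ | Ψ h t ≤ Ψ h 0} :=
      hcl.closure_subset_iff.2 fun h hh => key h hh
    rw [closure_Ioi] at hsub
    exact hsub self_mem_Ici
  simpa [hΨ, steklov_zero, hw.apply_zero] using hlim

theorem IsForcedMildSolution.energy (hE : IsEnergyForm T e B G η a C)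
    (hw : IsForcedMildSolution T B w₀ S w)
    (hwe : ∀ t, 0 ≤ t → ⟪w t, e⟫_ℝ = 0) (hSe : ∀ t, 0 ≤ t → ⟪S t, e⟫_ℝ = 0)
    {t : ℝ} (ht : 0 ≤ t) :
    Real.exp (-2 * η * t) * ⟪G (w t), w t⟫_ℝ
      + ∫ s in (0 : ℝ)..t, Real.exp (-2 * η * s) * (a * ‖w s‖ ^ 2 - C * ‖S s‖ ^ 2)
      ≤ ⟪G w₀, w₀⟫_ℝ := by
  have hmax : Continuous fun t : ℝ => max t 0 := by fun_prop
  have hext : ∀ {x : ℝ → H} {r : ℝ}, 0 ≤ r → (fun t => x (max t 0)) r = x r := fun {x r} hr => by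
    simp only [max_eq_left hr]
  have hint : ∀ {x : ℝ → H} {r : ℝ}, 0 ≤ r →
      ∫ s in (0 : ℝ)..r, x (max s 0) = ∫ s in (0 : ℝ)..r, x s := fun {x r} hr =>
    intervalIntegral.integral_congr fun s hs => by
      rw [uIcc_of_le hr] at hs
      exact hext (x := x) hs.1
  -- extension by constants to negative times
  have hw' : IsForcedMildSolution T B w₀ (fun t => S (max t 0)) (fun t => w (max t 0)) := by
    refine ⟨hw.continuousOn_forcing.congr fun r hr => hext hr,
      hw.continuousOn.congr fun r hr => hext hr, fun r hr => ?_⟩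
    obtain ⟨m, e1⟩ := hw.mild r hr
    have hm := m
    rw [← hint hr] at hm
    refine ⟨hm, ?_⟩
    simp only [hint hr, max_eq_left hr]
    exact e1
  have h := hw'.energy_of_continuous hE
    (hw.continuousOn.comp_continuous hmax fun t => le_max_right t 0)
    (hw.continuousOn_forcing.comp_continuous hmax fun t => le_max_right t 0)
    (fun t => hwe _ (le_max_right t 0)) (fun t => hSe _ (le_max_right t 0)) ht
  have hint2 : ∫ s in (0 : ℝ)..t, Real.exp (-2 * η * s)
        * (a * ‖w (max s 0)‖ ^ 2 - C * ‖S (max s 0)‖ ^ 2)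
      = ∫ s in (0 : ℝ)..t, Real.exp (-2 * η * s) * (a * ‖w s‖ ^ 2 - C * ‖S s‖ ^ 2) :=
    intervalIntegral.integral_congr fun s hs => by
      rw [uIcc_of_le ht] at hs
      simp only [max_eq_left hs.1]
  simp only [hint2, max_eq_left ht] at h
  exact h

end Energy

/-! ### Trajectories in a weighted `L²` space and the solution map -/

section Trajectory
variable {H : Type*} [NormedAddCommGroup H] [InnerProductSpace ℝ H]

/-- Trajectories `[0, ∞) → H`, square integrable in time. A solution `w` is represented by
`t ↦ exp (-η t) w(t)`. -/
def Trajectory (H : Type*) [NormedAddCommGroup H] [InnerProductSpace ℝ H] : Type _ :=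
  Lp H 2 ((volume : Measure ℝ).restrict (Ioi 0))

instance : NormedAddCommGroup (Trajectory H) := inferInstanceAs (NormedAddCommGroup (Lp H 2 _))

instance : InnerProductSpace ℝ (Trajectory H) := inferInstanceAs (InnerProductSpace ℝ (Lp H 2 _))

instance [CompleteSpace H] : CompleteSpace (Trajectory H) :=
  inferInstanceAs (CompleteSpace (Lp H 2 _))

/-- The trajectory given by a square integrable function. -/
def toTrajectory {v : ℝ → H} (hv : MemLp v 2 ((volume : Measure ℝ).restrict (Ioi 0))) :
    Trajectory H := hv.toLp v

theorem toTrajectory_congr {v w : ℝ → H}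
    (hv : MemLp v 2 ((volume : Measure ℝ).restrict (Ioi 0)))
    (hw : MemLp w 2 ((volume : Measure ℝ).restrict (Ioi 0))) (h : v = w) :
    toTrajectory hv = toTrajectory hw := by
  subst h; rfl

theorem toTrajectory_add {v w : ℝ → H}
    (hv : MemLp v 2 ((volume : Measure ℝ).restrict (Ioi 0)))
    (hw : MemLp w 2 ((volume : Measure ℝ).restrict (Ioi 0))) :
    toTrajectory (hv.add hw) = toTrajectory hv + toTrajectory hw := rfl

theorem toTrajectory_const_smul {v : ℝ → H} (c : ℝ)
    (hv : MemLp v 2 ((volume : Measure ℝ).restrict (Ioi 0))) :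
    toTrajectory (hv.const_smul c) = c • toTrajectory hv := rfl

/-- `t ↦ exp (-η t) w(t)`. -/
def damped (η : ℝ) (w : ℝ → H) (t : ℝ) : H := Real.exp (-η * t) • w t

theorem norm_damped_sq (η : ℝ) (w : ℝ → H) (t : ℝ) :
    ‖damped η w t‖ ^ 2 = Real.exp (-2 * η * t) * ‖w t‖ ^ 2 := by
  rw [damped, norm_smul, mul_pow, Real.norm_of_nonneg (Real.exp_pos _).le, ← Real.exp_nat_mul]
  congr 2
  push_cast
  ring

theorem continuousOn_damped {η : ℝ} {w : ℝ → H} (hw : ContinuousOn w (Ici 0)) :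
    ContinuousOn (damped η w) (Ici 0) := by
  unfold damped
  fun_prop

theorem aestronglyMeasurable_damped {η : ℝ} {w : ℝ → H} (hw : ContinuousOn w (Ici 0)) :
    AEStronglyMeasurable (damped η w) ((volume : Measure ℝ).restrict (Ioi 0)) :=
  ((continuousOn_damped hw).mono Ioi_subset_Ici_self).aestronglyMeasurable measurableSet_Ioi

theorem norm_sq_toTrajectory {v : ℝ → H} (hv : MemLp v 2 ((volume : Measure ℝ).restrict (Ioi 0))) :
    ‖toTrajectory hv‖ ^ 2 = ∫ t in Ioi (0 : ℝ), ‖v t‖ ^ 2 := by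
  change ‖hv.toLp v‖ ^ 2 = _
  rw [← real_inner_self_eq_norm_sq, L2.inner_def]
  refine integral_congr_ae ?_
  filter_upwards [hv.coeFn_toLp] with t ht
  rw [ht, real_inner_self_eq_norm_sq]

theorem intervalIntegral_damped_le {η : ℝ} {w : ℝ → H}
    (hv : MemLp (damped η w) 2 ((volume : Measure ℝ).restrict (Ioi 0))) {t : ℝ} (ht : 0 ≤ t) :
    ∫ s in (0 : ℝ)..t, ‖damped η w s‖ ^ 2 ≤ ‖toTrajectory hv‖ ^ 2 := by
  rw [norm_sq_toTrajectory, intervalIntegral.integral_of_le ht]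
  exact setIntegral_mono_set ((memLp_two_iff_integrable_sq_norm hv.1).1 hv)
    (Filter.Eventually.of_forall fun s => by positivity)
    (Filter.Eventually.of_forall Ioc_subset_Ioi_self)

theorem memLp_damped_of_bound {η R : ℝ} {w : ℝ → H} (hw : ContinuousOn w (Ici 0))
    (hR : ∀ t, 0 ≤ t → ∫ s in (0 : ℝ)..t, ‖damped η w s‖ ^ 2 ≤ R) :
    MemLp (damped η w) 2 ((volume : Measure ℝ).restrict (Ioi 0)) := by
  rw [memLp_two_iff_integrable_sq_norm (aestronglyMeasurable_damped hw)]
  refine integrableOn_Ioi_of_intervalIntegral_norm_bounded (l := Filter.atTop) (b := id) R 0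
    (fun i => ?_) Filter.tendsto_id ?_
  · refine (ContinuousOn.integrableOn_Icc ?_).mono_set Ioc_subset_Icc_self
    exact ((continuousOn_damped hw).mono Icc_subset_Ici_self).norm.pow 2
  · filter_upwards [Filter.eventually_ge_atTop 0] with t ht
    simpa using hR t ht

theorem norm_sq_toTrajectory_damped_le {η R : ℝ} {w : ℝ → H}
    (hv : MemLp (damped η w) 2 ((volume : Measure ℝ).restrict (Ioi 0)))
    (hR : ∀ t, 0 ≤ t → ∫ s in (0 : ℝ)..t, ‖damped η w s‖ ^ 2 ≤ R) : ‖toTrajectory hv‖ ^ 2 ≤ R := by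
  rw [norm_sq_toTrajectory]
  refine le_of_tendsto (intervalIntegral_tendsto_integral_Ioi (l := Filter.atTop) (b := id) 0
    ((memLp_two_iff_integrable_sq_norm hv.1).1 hv) Filter.tendsto_id) ?_
  filter_upwards [Filter.eventually_ge_atTop 0] with t ht using hR t ht

variable {T : H →ₗ.[ℝ] H} {e : H} {B G : H →L[ℝ] H} {η a C : ℝ} {w₀ : H} {S w : ℝ → H}

variable (T e B η) in
/-- Triples `(w₀, S, w)` of initial datum, forcing term and solution, with `S` and `w` orthogonal
to `e` and square integrable in time with weight `exp (-2 η t)`. -/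
def solutionTriples : Submodule ℝ (H × (ℝ → H) × (ℝ → H)) where
  carrier := {p | IsForcedMildSolution T B p.1 p.2.1 p.2.2 ∧
    (∀ t, 0 ≤ t → ⟪p.2.1 t, e⟫_ℝ = 0) ∧ (∀ t, 0 ≤ t → ⟪p.2.2 t, e⟫_ℝ = 0) ∧
    MemLp (damped η p.2.1) 2 ((volume : Measure ℝ).restrict (Ioi 0)) ∧
    MemLp (damped η p.2.2) 2 ((volume : Measure ℝ).restrict (Ioi 0))}
  add_mem' := by
    rintro ⟨w₁, S₁, u₁⟩ ⟨w₂, S₂, u₂⟩ ⟨h1, h2, h3, h4, h5⟩ ⟨k1, k2, k3, k4, k5⟩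
    have hint : ∀ {x y : ℝ → H}, ContinuousOn x (Ici 0) → ContinuousOn y (Ici 0) → ∀ t, 0 ≤ t →
        ∫ s in (0 : ℝ)..t, (x + y) s = (∫ s in (0 : ℝ)..t, x s) + ∫ s in (0 : ℝ)..t, y s := by
      intro x y hx hy t ht
      have hsub : uIcc 0 t ⊆ Ici (0 : ℝ) := by
        rw [uIcc_of_le ht]; exact Icc_subset_Ici_self
      exact intervalIntegral.integral_add (hx.mono hsub).intervalIntegrable
        (hy.mono hsub).intervalIntegrable
    refine ⟨⟨h1.1.add k1.1, h1.2.add k1.2, fun t ht => ?_⟩, fun t ht => ?_, fun t ht => ?_, ?_, ?_⟩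
    · obtain ⟨m1, e1⟩ := h1.mild t ht
      obtain ⟨m2, e2⟩ := k1.mild t ht
      have hi := hint h1.2 k1.2 t ht
      have hm : (∫ s in (0 : ℝ)..t, (u₁ + u₂) s) ∈ T.domain := by
        rw [hi]; exact T.domain.add_mem m1 m2
      refine ⟨hm, ?_⟩
      have hT : T ⟨_, hm⟩ = T ⟨_, m1⟩ + T ⟨_, m2⟩ := by
        rw [← LinearPMap.map_add]
        congr 1
        exact Subtype.ext hi
      change u₁ t + u₂ t = (w₁ + w₂) - T ⟨_, hm⟩ + B (∫ s in (0 : ℝ)..t, (u₁ + u₂) s)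
        + ∫ s in (0 : ℝ)..t, (S₁ + S₂) s
      change u₁ t = _ at e1
      change u₂ t = _ at e2
      rw [hT, hi, hint h1.1 k1.1 t ht, e1, e2, map_add]
      dsimp only
      abel
    · change ⟪S₁ t + S₂ t, e⟫_ℝ = 0
      rw [inner_add_left, h2 t ht, k2 t ht, add_zero]
    · change ⟪u₁ t + u₂ t, e⟫_ℝ = 0
      rw [inner_add_left, h3 t ht, k3 t ht, add_zero]
    · convert h4.add k4 using 1
      funext t
      simp [damped]
    · convert h5.add k5 using 1
      funext t
      simp [damped]
  zero_mem' := by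
    refine ⟨⟨continuousOn_const, continuousOn_const, fun t _ => ?_⟩, fun t _ => ?_, fun t _ => ?_,
      ?_, ?_⟩
    · have hz : (∫ s in (0 : ℝ)..t, (0 : ℝ → H) s) = 0 := by simp
      have hm : (∫ s in (0 : ℝ)..t, (0 : ℝ → H) s) ∈ T.domain := by
        rw [hz]; exact T.domain.zero_mem
      refine ⟨hm, ?_⟩
      have hT : T ⟨_, hm⟩ = 0 := by
        rw [← LinearPMap.map_zero T]
        congr 1
        exact Subtype.ext hz
      change (0 : H) = 0 - T ⟨_, hm⟩ + B (∫ s in (0 : ℝ)..t, (0 : ℝ → H) s)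
        + ∫ s in (0 : ℝ)..t, (0 : ℝ → H) s
      rw [hT, hz]
      simp
    · exact inner_zero_left _
    · exact inner_zero_left _
    · convert MemLp.zero (ε := H) using 1
      funext t
      simp [damped]
    · convert MemLp.zero (ε := H) using 1
      funext t
      simp [damped]
  smul_mem' := by
    rintro c ⟨w₁, S₁, u₁⟩ ⟨h1, h2, h3, h4, h5⟩
    have hint : ∀ (x : ℝ → H) (t : ℝ),
        ∫ s in (0 : ℝ)..t, (c • x) s = c • ∫ s in (0 : ℝ)..t, x s := fun x t =>
      intervalIntegral.integral_smul c x
    refine ⟨⟨h1.1.const_smul c, h1.2.const_smul c, fun t ht => ?_⟩, fun t ht => ?_,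
      fun t ht => ?_, ?_, ?_⟩
    · obtain ⟨m1, e1⟩ := h1.mild t ht
      have hi := hint u₁ t
      have hm : (∫ s in (0 : ℝ)..t, (c • u₁) s) ∈ T.domain := by
        rw [hi]; exact T.domain.smul_mem c m1
      refine ⟨hm, ?_⟩
      have hT : T ⟨_, hm⟩ = c • T ⟨_, m1⟩ := by
        rw [← LinearPMap.map_smul]
        congr 1
        exact Subtype.ext hi
      change c • u₁ t = c • w₁ - T ⟨_, hm⟩ + B (∫ s in (0 : ℝ)..t, (c • u₁) s)
        + ∫ s in (0 : ℝ)..t, (c • S₁) s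
      change u₁ t = _ at e1
      rw [hT, hi, hint S₁, e1, map_smul]
      dsimp only
      module
    · change ⟪c • S₁ t, e⟫_ℝ = 0
      rw [inner_smul_left, h2 t ht, mul_zero]
    · change ⟪c • u₁ t, e⟫_ℝ = 0
      rw [inner_smul_left, h3 t ht, mul_zero]
    · convert h4.const_smul c using 1
      funext t
      simp [damped, smul_comm c]
    · convert h5.const_smul c using 1
      funext t
      simp [damped, smul_comm c]

/-- The data `(w₀, S)` of a triple, in the Hilbert space `H ⊕ L²`. -/
def dataMap : solutionTriples T e B η →ₗ[ℝ] WithLp 2 (H × Trajectory H) where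
  toFun p := WithLp.toLp 2 (p.1.1, toTrajectory p.2.2.2.2.1)
  map_add' p q := by
    have : toTrajectory (p + q).2.2.2.2.1
        = toTrajectory p.2.2.2.2.1 + toTrajectory q.2.2.2.2.1 := by
      rw [← toTrajectory_add]
      exact toTrajectory_congr _ _ (by funext t; simp [damped])
    rw [this]
    rfl
  map_smul' c p := by
    have : toTrajectory (c • p).2.2.2.2.1 = c • toTrajectory p.2.2.2.2.1 := by
      rw [← toTrajectory_const_smul]
      exact toTrajectory_congr _ _ (by funext t; simp [damped, smul_comm c])
    rw [this]
    rfl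

/-- The trajectory of the solution of a triple. -/
def trajectoryMap : solutionTriples T e B η →ₗ[ℝ] Trajectory H where
  toFun p := toTrajectory p.2.2.2.2.2
  map_add' p q := by
    rw [← toTrajectory_add]
    exact toTrajectory_congr _ _ (by funext t; simp [damped])
  map_smul' c p := by
    rw [RingHom.id_apply, ← toTrajectory_const_smul]
    exact toTrajectory_congr _ _ (by funext t; simp [damped, smul_comm c])

/-- The value at time `t` of the solution of a triple. -/
def evalMap (t : ℝ) : solutionTriples T e B η →ₗ[ℝ] H where
  toFun p := p.1.2.2 t
  map_add' _ _ := rfl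
  map_smul' _ _ := rfl

theorem norm_dataMap_sq (p : solutionTriples T e B η) :
    ‖dataMap p‖ ^ 2 = ‖p.1.1‖ ^ 2 + ‖toTrajectory p.2.2.2.2.1‖ ^ 2 :=
  WithLp.prod_norm_sq_eq_of_L2 _

variable [CompleteSpace H]

theorem IsForcedMildSolution.damped_energy (hE : IsEnergyForm T e B G η a C)
    (hw : IsForcedMildSolution T B w₀ S w)
    (hwe : ∀ t, 0 ≤ t → ⟪w t, e⟫_ℝ = 0) (hSe : ∀ t, 0 ≤ t → ⟪S t, e⟫_ℝ = 0)
    {t : ℝ} (ht : 0 ≤ t) :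
    1 / 2 * ‖damped η w t‖ ^ 2 + a * ∫ s in (0 : ℝ)..t, ‖damped η w s‖ ^ 2
      ≤ 2 * ‖w₀‖ ^ 2 + C * ∫ s in (0 : ℝ)..t, ‖damped η S s‖ ^ 2 := by
  have h := hw.energy hE hwe hSe ht
  have hsub : uIcc 0 t ⊆ Ici (0 : ℝ) := by
    rw [uIcc_of_le ht]; exact Icc_subset_Ici_self
  have hi : ∀ {x : ℝ → H}, ContinuousOn x (Ici 0) →
      IntervalIntegrable (fun s => ‖damped η x s‖ ^ 2) volume 0 t := fun hx =>
    (((continuousOn_damped hx).mono hsub).norm.pow 2).intervalIntegrable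
  have h1 : ∫ s in (0 : ℝ)..t, Real.exp (-2 * η * s) * (a * ‖w s‖ ^ 2 - C * ‖S s‖ ^ 2)
      = a * (∫ s in (0 : ℝ)..t, ‖damped η w s‖ ^ 2)
        - C * ∫ s in (0 : ℝ)..t, ‖damped η S s‖ ^ 2 := by
    rw [← intervalIntegral.integral_const_mul, ← intervalIntegral.integral_const_mul,
      ← intervalIntegral.integral_sub ((hi hw.continuousOn).const_mul a)
        ((hi hw.continuousOn_forcing).const_mul C)]
    refine intervalIntegral.integral_congr fun s _ => ?_
    simp only [norm_damped_sq]
    ring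
  rw [h1] at h
  have h2 := mul_le_mul_of_nonneg_left (hE.lower (w t)) (Real.exp_pos (-2 * η * t)).le
  have h3 := hE.upper w₀
  rw [norm_damped_sq]
  linarith

/-- The square-integrated and the pointwise form of the energy estimate. -/
theorem solutionTriples_bounds (hE : IsEnergyForm T e B G η a C) (ha : 0 < a) (hC : 2 ≤ C)
    (p : solutionTriples T e B η) :
    ‖trajectoryMap p‖ ≤ √(C / a) * ‖dataMap p‖ ∧
      ∀ t, 0 ≤ t → ‖evalMap t p‖ ≤ √(2 * C) * Real.exp (η * t) * ‖dataMap p‖ := by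
  obtain ⟨⟨w₀, S, w⟩, hw, hSe, hwe, hS, hwL⟩ := p
  set p : solutionTriples T e B η := ⟨⟨w₀, S, w⟩, hw, hSe, hwe, hS, hwL⟩ with hp
  have hd : ‖dataMap p‖ ^ 2 = ‖w₀‖ ^ 2 + ‖toTrajectory hS‖ ^ 2 := norm_dataMap_sq p
  have key : ∀ t, 0 ≤ t → 1 / 2 * ‖damped η w t‖ ^ 2
      + a * ∫ s in (0 : ℝ)..t, ‖damped η w s‖ ^ 2 ≤ C * ‖dataMap p‖ ^ 2 := by
    intro t ht
    have h1 := hw.damped_energy hE hwe hSe ht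
    have h2 := intervalIntegral_damped_le hS ht
    rw [hd]
    nlinarith [sq_nonneg ‖w₀‖]
  constructor
  · refine abs_le_of_sq_le_sq' ?_ (by positivity) |>.2
    rw [mul_pow, Real.sq_sqrt (by positivity)]
    refine norm_sq_toTrajectory_damped_le hwL fun t ht => ?_
    rw [div_mul_eq_mul_div, le_div_iff₀ ha]
    nlinarith [key t ht, sq_nonneg ‖damped η w t‖]
  · intro t ht
    refine abs_le_of_sq_le_sq' ?_ (by positivity) |>.2
    rw [mul_pow, mul_pow, Real.sq_sqrt (by positivity), ← Real.exp_nat_mul]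
    have h1 : ‖damped η w t‖ ^ 2 ≤ 2 * C * ‖dataMap p‖ ^ 2 := by
      have : 0 ≤ ∫ s in (0 : ℝ)..t, ‖damped η w s‖ ^ 2 :=
        intervalIntegral.integral_nonneg ht fun s _ => by positivity
      nlinarith [key t ht, mul_nonneg ha.le this]
    rw [norm_damped_sq] at h1
    have h2 : Real.exp ((2 : ℕ) * (η * t)) * Real.exp (-2 * η * t) = 1 := by
      rw [← Real.exp_add, ← Real.exp_zero]
      congr 1
      push_cast
      ring
    calc ‖evalMap t p‖ ^ 2
        = Real.exp ((2 : ℕ) * (η * t)) * (Real.exp (-2 * η * t) * ‖w t‖ ^ 2) := by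
          rw [← mul_assoc, h2, one_mul]; rfl
      _ ≤ Real.exp ((2 : ℕ) * (η * t)) * (2 * C * ‖dataMap p‖ ^ 2) := by gcongr
      _ = _ := by ring

end Trajectory

/-! ### Dependence of mild solutions on a parameter -/

section Parameter
variable {H : Type*} [NormedAddCommGroup H] [InnerProductSpace ℝ H]

/-- Action of an operator of `H` on trajectories, pointwise in time. -/
def pointwiseAction (H : Type*) [NormedAddCommGroup H] [InnerProductSpace ℝ H] :
    (H →L[ℝ] H) →L[ℝ] Trajectory H →L[ℝ] Trajectory H :=
  ContinuousLinearMap.compLpL₂ 2 _ (ContinuousLinearMap.id ℝ (H →L[ℝ] H))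

theorem norm_pointwiseAction_le : ‖pointwiseAction H‖ ≤ 1 :=
  (ContinuousLinearMap.norm_compLpL₂_le _).trans ContinuousLinearMap.norm_id_le

theorem pointwiseAction_toTrajectory {η : ℝ} {w : ℝ → H} (B : H →L[ℝ] H)
    (hw : MemLp (damped η w) 2 ((volume : Measure ℝ).restrict (Ioi 0))) :
    ∃ hB : MemLp (damped η fun t => B (w t)) 2 ((volume : Measure ℝ).restrict (Ioi 0)),
      pointwiseAction H B (toTrajectory hw) = toTrajectory hB := by
  have h1 : (damped η fun t => B (w t)) = fun t => B (damped η w t) := by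
    funext t; simp [damped]
  have h2 : MemLp (damped η fun t => B (w t)) 2 ((volume : Measure ℝ).restrict (Ioi 0)) := by
    rw [h1]; exact B.comp_memLp' hw
  refine ⟨h2, Lp.ext ?_⟩
  have h3 := ContinuousLinearMap.coeFn_compLp B (hw.toLp _)
  have h4 : B.compLp (hw.toLp _) =ᵐ[(volume : Measure ℝ).restrict (Ioi 0)] h2.toLp _ := by
    filter_upwards [h3, hw.coeFn_toLp, h2.coeFn_toLp] with t e1 e2 e3
    rw [e1, e2, e3, h1]
  exact h4

/-- Inclusion of initial data. -/
def initialIncl (H : Type*) [NormedAddCommGroup H] [InnerProductSpace ℝ H] :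
    H →L[ℝ] WithLp 2 (H × Trajectory H) :=
  (WithLp.prodContinuousLinearEquiv 2 ℝ H (Trajectory H)).symm.toContinuousLinearMap ∘L
    ContinuousLinearMap.inl ℝ H (Trajectory H)

/-- Inclusion of forcing terms. -/
def forcingIncl (H : Type*) [NormedAddCommGroup H] [InnerProductSpace ℝ H] :
    Trajectory H →L[ℝ] WithLp 2 (H × Trajectory H) :=
  (WithLp.prodContinuousLinearEquiv 2 ℝ H (Trajectory H)).symm.toContinuousLinearMap ∘L
    ContinuousLinearMap.inr ℝ H (Trajectory H)

theorem norm_initialIncl_le : ‖initialIncl H‖ ≤ 1 := by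
  refine ContinuousLinearMap.opNorm_le_bound _ zero_le_one fun x => ?_
  have h : ‖initialIncl H x‖ ^ 2 = ‖x‖ ^ 2 := by
    rw [WithLp.prod_norm_sq_eq_of_L2]
    simp [initialIncl]
  rw [one_mul]
  exact le_of_eq ((sq_eq_sq₀ (norm_nonneg _) (norm_nonneg _)).1 h)

theorem norm_forcingIncl_le : ‖forcingIncl H‖ ≤ 1 := by
  refine ContinuousLinearMap.opNorm_le_bound _ zero_le_one fun x => ?_
  have h : ‖forcingIncl H x‖ ^ 2 = ‖x‖ ^ 2 := by
    rw [WithLp.prod_norm_sq_eq_of_L2]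
    simp [forcingIncl]
  rw [one_mul]
  exact le_of_eq ((sq_eq_sq₀ (norm_nonneg _) (norm_nonneg _)).1 h)

variable {X : Type*} [NormedAddCommGroup X] [NormedSpace ℝ X]

/-- For a solution map `K`, the operator sending a perturbation `D` of the generator to
`u ↦ K (0, D u)`. -/
def perturbation (K : WithLp 2 (H × Trajectory H) →L[ℝ] X) :
    (H →L[ℝ] H) →L[ℝ] Trajectory H →L[ℝ] X :=
  (ContinuousLinearMap.compL ℝ (Trajectory H) (Trajectory H) X (K ∘L forcingIncl H)) ∘L
    pointwiseAction H

theorem norm_perturbation_le {K : WithLp 2 (H × Trajectory H) →L[ℝ] X} {κ : ℝ} (hK : ‖K‖ ≤ κ) :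
    ‖perturbation K‖ ≤ κ := by
  have hκ : 0 ≤ κ := (norm_nonneg K).trans hK
  refine ContinuousLinearMap.opNorm_le_bound _ hκ fun D => ?_
  calc ‖(K ∘L forcingIncl H) ∘L (pointwiseAction H D)‖
      ≤ ‖K ∘L forcingIncl H‖ * ‖pointwiseAction H D‖ := ContinuousLinearMap.opNorm_comp_le _ _
    _ ≤ (‖K‖ * ‖forcingIncl H‖) * (‖pointwiseAction H‖ * ‖D‖) := by
        gcongr
        · exact ContinuousLinearMap.opNorm_comp_le _ _
        · exact ContinuousLinearMap.le_opNorm _ _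
    _ ≤ (κ * 1) * (1 * ‖D‖) := by
        gcongr
        · exact norm_forcingIncl_le
        · exact norm_pointwiseAction_le
    _ = κ * ‖D‖ := by ring

variable {Z : Type*} [NormedAddCommGroup Z] [NormedSpace ℝ Z] {Ω : Set Z}

theorem norm_iteratedFDerivWithin_perturbation_le (hΩ : UniqueDiffOn ℝ Ω)
    {K : WithLp 2 (H × Trajectory H) →L[ℝ] X} {κ : ℝ} (hK : ‖K‖ ≤ κ) {B : Z → H →L[ℝ] H}
    (hB : ContDiffOn ℝ ∞ B Ω) {m : ℝ} {z₀ : Z} (hz : z₀ ∈ Ω) (B₀ : H →L[ℝ] H) {k : ℕ} (hk : 0 < k)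
    (hm : ‖iteratedFDerivWithin ℝ k B Ω z₀‖ ≤ k.factorial * m) :
    ‖iteratedFDerivWithin ℝ k (fun z => perturbation K (B z - B₀)) Ω z₀‖
      ≤ k.factorial * (κ * m) := by
  have hκ : 0 ≤ κ := (norm_nonneg K).trans hK
  have h1 : ContDiffWithinAt ℝ ∞ (fun z => B z - B₀) Ω z₀ := (hB z₀ hz).sub contDiffWithinAt_const
  refine ((perturbation K).norm_iteratedFDerivWithin_comp_left h1 hΩ hz
    (by exact_mod_cast le_top)).trans ?_
  have h2 : iteratedFDerivWithin ℝ k (fun z => B z - B₀) Ω z₀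
      = iteratedFDerivWithin ℝ k B Ω z₀ := by
    rw [fun_iteratedFDerivWithin_sub_apply ((hB z₀ hz).of_le (by exact_mod_cast le_top))
      contDiffWithinAt_const hΩ hz, iteratedFDerivWithin_const_of_ne hk.ne', Pi.zero_apply,
      sub_zero]
  rw [h2]
  calc _ ≤ κ * (k.factorial * m) := by
        gcongr
        exact norm_perturbation_le hK
    _ = _ := by ring

theorem norm_iteratedFDerivWithin_initial_le (hΩ : UniqueDiffOn ℝ Ω)
    {K : WithLp 2 (H × Trajectory H) →L[ℝ] X} {κ : ℝ} (hK : ‖K‖ ≤ κ) {f₀ : Z → H}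
    (hf : ContDiffOn ℝ ∞ f₀ Ω) {r : ℝ} (hr : 0 ≤ r) {z₀ : Z} (hz : z₀ ∈ Ω) {l : ℕ}
    (hl : ‖iteratedFDerivWithin ℝ l f₀ Ω z₀‖ ≤ r ^ l) :
    ‖iteratedFDerivWithin ℝ l (fun z => K (initialIncl H (f₀ z))) Ω z₀‖
      ≤ l.factorial * (κ * Real.exp r) := by
  have hκ : 0 ≤ κ := (norm_nonneg K).trans hK
  refine ((K ∘L initialIncl H).norm_iteratedFDerivWithin_comp_left (hf z₀ hz) hΩ hz
    (by exact_mod_cast le_top)).trans ?_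
  have h1 : ‖K ∘L initialIncl H‖ ≤ κ * 1 :=
    (ContinuousLinearMap.opNorm_comp_le _ _).trans
      (mul_le_mul hK norm_initialIncl_le (norm_nonneg _) hκ)
  have h2 : r ^ l ≤ l.factorial * Real.exp r := by
    have := Real.pow_div_factorial_le_exp r hr l
    rwa [div_le_iff₀' (by positivity)] at this
  calc _ ≤ (κ * 1) * (l.factorial * Real.exp r) :=
        mul_le_mul h1 (hl.trans h2) (norm_nonneg _) (by positivity)
    _ = _ := by ring

variable [CompleteSpace H] {T : H →ₗ.[ℝ] H} {e : H} {η a C : ℝ}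

/-- Solution maps: the trajectory and the value at time `t` are bounded linear functions of the
initial datum and the forcing term. Since `T` need not generate a semigroup, they are the solution
only for data that do have one. -/
theorem exists_solutionMap {B G : H →L[ℝ] H} (hE : IsEnergyForm T e B G η a C) (ha : 0 < a)
    (hC : 2 ≤ C) :
    (∃ K : WithLp 2 (H × Trajectory H) →L[ℝ] Trajectory H, ‖K‖ ≤ √(C / a) ∧
      ∀ p : solutionTriples T e B η, K (dataMap p) = trajectoryMap p) ∧
    ∀ t, 0 ≤ t → ∃ K : WithLp 2 (H × Trajectory H) →L[ℝ] H,
      ‖K‖ ≤ √(2 * C) * Real.exp (η * t) ∧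
      ∀ p : solutionTriples T e B η, K (dataMap p) = evalMap t p := by
  constructor
  · obtain ⟨K, h1, h2⟩ := exists_continuousLinearMap_comp_eq (dataMap (T := T) (e := e) (B := B)
      (η := η)) trajectoryMap (by positivity) fun p => (solutionTriples_bounds hE ha hC p).1
    exact ⟨K, h2, h1⟩
  · intro t ht
    obtain ⟨K, h1, h2⟩ := exists_continuousLinearMap_comp_eq (dataMap (T := T) (e := e) (B := B)
      (η := η)) (evalMap t) (by positivity) fun p => (solutionTriples_bounds hE ha hC p).2 t ht
    exact ⟨K, h2, h1⟩

/-- Smooth dependence on the parameter, with bounds on the derivatives. Around `z₀`, the solution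
with generator `-T + B z` is regarded as the solution with generator `-T + B z₀` and forcing term
`(B z - B z₀) f(z)`; the solution map at `z₀` turns this into a linear equation for the trajectory
whose coefficient vanishes at `z₀`. -/
theorem contDiffOn_and_norm_iteratedFDerivWithin_le (hΩ : UniqueDiffOn ℝ Ω)
    {B : Z → H →L[ℝ] H} (hB : ContDiffOn ℝ ∞ B Ω) {m : ℝ}
    (hm : ∀ l : ℕ, ∀ z ∈ Ω, ‖iteratedFDerivWithin ℝ l B Ω z‖ ≤ l.factorial * m)
    (hBe : ∀ z ∈ Ω, ∀ x, ⟪B z x, e⟫_ℝ = 0)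
    {f₀ : Z → H} (hf₀ : ContDiffOn ℝ ∞ f₀ Ω) {r : ℝ} (hr : 0 ≤ r)
    (hf₀r : ∀ l : ℕ, ∀ z ∈ Ω, ‖iteratedFDerivWithin ℝ l f₀ Ω z‖ ≤ r ^ l)
    (ha : 0 < a) (hC : 2 ≤ C) (hE : ∀ z ∈ Ω, ∃ G, IsEnergyForm T e (B z) G η a C)
    {f : ℝ → Z → H} (hf : ∀ z ∈ Ω, IsForcedMildSolution T (B z) (f₀ z) 0 fun t => f t z)
    (hfe : ∀ z ∈ Ω, ∀ t, 0 ≤ t → ⟪f t z, e⟫_ℝ = 0) {t : ℝ} (ht : 0 ≤ t) :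
    ContDiffOn ℝ ∞ (f t) Ω ∧ ∀ l : ℕ, ∀ z ∈ Ω, ‖iteratedFDerivWithin ℝ l (f t) Ω z‖
      ≤ l.factorial * (√(2 * C) * Real.exp (η * t) * Real.exp r * (1 + √(C / a) * m) ^ l) := by
  classical
  set κ := √(C / a) with hκ
  set κt := √(2 * C) * Real.exp (η * t) with hκt
  have hL : ∀ z ∈ Ω, MemLp (damped η fun t => f t z) 2
      ((volume : Measure ℝ).restrict (Ioi 0)) := by
    intro z hz
    obtain ⟨G, hG⟩ := hE z hz
    refine memLp_damped_of_bound (R := 2 * ‖f₀ z‖ ^ 2 / a) (hf z hz).continuousOn fun t ht => ?_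
    have h := (hf z hz).damped_energy hG (hfe z hz) (fun t _ => inner_zero_left _) ht
    have h0 : ∫ s in (0 : ℝ)..t, ‖damped η (0 : ℝ → H) s‖ ^ 2 = 0 := by simp [damped]
    rw [h0, mul_zero, add_zero] at h
    rw [le_div_iff₀ ha]
    nlinarith [sq_nonneg ‖damped η (fun t => f t z) t‖]
  -- the whole trajectory as a function of the parameter
  set u : Z → Trajectory H := fun z => if hz : z ∈ Ω then toTrajectory (hL z hz) else 0 with hu
  -- the fixed point equations based at `z₀`
  have hfix : ∀ z₀ ∈ Ω, ∃ (K : WithLp 2 (H × Trajectory H) →L[ℝ] Trajectory H)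
      (K' : WithLp 2 (H × Trajectory H) →L[ℝ] H), ‖K‖ ≤ κ ∧ ‖K'‖ ≤ κt ∧
      (∀ z ∈ Ω, u z = K (initialIncl H (f₀ z)) + perturbation K (B z - B z₀) (u z)) ∧
      ∀ z ∈ Ω, f t z = K' (initialIncl H (f₀ z)) + perturbation K' (B z - B z₀) (u z) := by
    intro z₀ hz₀
    obtain ⟨G, hG⟩ := hE z₀ hz₀
    obtain ⟨⟨K, hK1, hK2⟩, hK'⟩ := exists_solutionMap hG ha hC
    obtain ⟨K', hK'1, hK'2⟩ := hK' t ht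
    have htriple : ∀ z ∈ Ω, ∃ p : solutionTriples T e (B z₀) η,
        dataMap p = initialIncl H (f₀ z)
          + forcingIncl H (pointwiseAction H (B z - B z₀) (u z)) ∧
        trajectoryMap p = u z ∧ evalMap t p = f t z := by
      intro z hz
      obtain ⟨hS, hS'⟩ := pointwiseAction_toTrajectory (B z - B z₀) (hL z hz)
      have huz : u z = toTrajectory (hL z hz) := by rw [hu]; exact dif_pos hz
      have hmild : IsForcedMildSolution T (B z₀) (f₀ z) (fun t => (B z - B z₀) (f t z))
          fun t => f t z := by
        refine ⟨(B z - B z₀).continuous.comp_continuousOn (hf z hz).continuousOn,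
          (hf z hz).continuousOn, fun t ht => ?_⟩
        obtain ⟨h1, h2⟩ := (hf z hz).mild t ht
        refine ⟨h1, ?_⟩
        have hsub : uIcc 0 t ⊆ Ici (0 : ℝ) := by
          rw [uIcc_of_le ht]; exact Icc_subset_Ici_self
        rw [ContinuousLinearMap.intervalIntegral_comp_comm _
          ((hf z hz).continuousOn.mono hsub).intervalIntegrable, h2, sub_apply]
        simp
      refine ⟨⟨(f₀ z, (fun t => (B z - B z₀) (f t z)), fun t => f t z), hmild, fun t ht => ?_,
        hfe z hz, hS, hL z hz⟩, ?_, huz.symm, rfl⟩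
      · change ⟪(B z - B z₀) (f t z), e⟫_ℝ = 0
        rw [sub_apply, inner_sub_left, hBe z hz, hBe z₀ hz₀, sub_zero]
      · rw [huz, hS']
        refine (WithLp.ofLp_injective 2) (Prod.ext ?_ ?_)
        · change f₀ z = f₀ z + 0
          rw [add_zero]
        · change toTrajectory hS = 0 + toTrajectory hS
          rw [zero_add]
    refine ⟨K, K', hK1, hK'1, fun z hz => ?_, fun z hz => ?_⟩
    · obtain ⟨p, h1, h2, -⟩ := htriple z hz
      have h4 := hK2 p
      rw [h1, map_add, h2] at h4
      exact h4.symm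
    · obtain ⟨p, h1, -, h3⟩ := htriple z hz
      rw [← h3, ← hK'2 p, h1, map_add]
      rfl
  have hsub : ∀ z₀ ∈ Ω, ContDiffOn ℝ ∞ (fun z => B z - B z₀) Ω := fun z₀ _ =>
    hB.sub contDiffOn_const
  have husmooth : ContDiffOn ℝ ∞ u Ω := by
    intro z₀ hz₀
    obtain ⟨K, -, -, -, hu1, -⟩ := hfix z₀ hz₀
    refine contDiffWithinAt_of_eq_add_apply hz₀ (g := fun z => K (initialIncl H (f₀ z)))
      (M := fun z => perturbation K (B z - B z₀)) (by simp) ?_ ?_ hu1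
    · exact (perturbation K).contDiff.comp_contDiffWithinAt (hsub z₀ hz₀ z₀ hz₀)
    · exact (K ∘L initialIncl H).contDiff.comp_contDiffWithinAt (hf₀ z₀ hz₀)
  have hm0 : Ω.Nonempty → 0 ≤ m := by
    rintro ⟨z, hz⟩
    simpa using (norm_nonneg _).trans (hm 0 z hz)
  have hubound : ∀ l : ℕ, ∀ z ∈ Ω, ‖iteratedFDerivWithin ℝ l u Ω z‖
      ≤ l.factorial * (κ * Real.exp r * (1 + κ * m) ^ l) := by
    intro l
    induction l using Nat.strong_induction_on with
    | _ l ih =>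
      intro z₀ hz₀
      obtain ⟨K, -, hK, -, hu1, -⟩ := hfix z₀ hz₀
      refine (norm_iteratedFDerivWithin_add_apply_le hΩ hz₀
        (g := fun z => K (initialIncl H (f₀ z)))
        (N := fun z => perturbation K (B z - B z₀)) (by simp)
        ((perturbation K).contDiff.comp_contDiffOn (hsub z₀ hz₀))
        ((K ∘L initialIncl H).contDiff.comp_contDiffOn hf₀) husmooth hu1
        (norm_iteratedFDerivWithin_initial_le hΩ hK hf₀ hr hz₀ (hf₀r l z₀ hz₀))
        (fun k hk => norm_iteratedFDerivWithin_perturbation_le hΩ hK hB hz₀ _ hk (hm k z₀ hz₀))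
        (fun j hj => ih j hj z₀ hz₀)).trans (le_of_eq ?_)
      -- the recursion closes because `1 + κ m ∑_{j < l} (1 + κ m) ^ j = (1 + κ m) ^ l`
      have hgeom := geom_sum_mul (1 + κ * m) l
      congr 1
      linear_combination κ * Real.exp r * hgeom
  refine ⟨fun z₀ hz₀ => ?_, fun l z₀ hz₀ => ?_⟩
  · obtain ⟨-, K', -, -, -, hu2⟩ := hfix z₀ hz₀
    refine ContDiffWithinAt.congr ?_ hu2 (hu2 z₀ hz₀)
    refine ContDiffWithinAt.add ?_ ?_
    · exact (K' ∘L initialIncl H).contDiff.comp_contDiffWithinAt (hf₀ z₀ hz₀)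
    · exact ((perturbation K').contDiff.comp_contDiffWithinAt (hsub z₀ hz₀ z₀ hz₀)).clm_apply
        (husmooth z₀ hz₀)
  · obtain ⟨-, K', -, hK', -, hu2⟩ := hfix z₀ hz₀
    refine (norm_iteratedFDerivWithin_add_apply_le hΩ hz₀
      (g := fun z => K' (initialIncl H (f₀ z)))
      (N := fun z => perturbation K' (B z - B z₀)) (by simp)
      ((perturbation K').contDiff.comp_contDiffOn (hsub z₀ hz₀))
      ((K' ∘L initialIncl H).contDiff.comp_contDiffOn hf₀) husmooth hu2
      (norm_iteratedFDerivWithin_initial_le hΩ hK' hf₀ hr hz₀ (hf₀r l z₀ hz₀))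
      (fun k hk => norm_iteratedFDerivWithin_perturbation_le hΩ hK' hB hz₀ _ hk (hm k z₀ hz₀))
      (fun j _ => hubound j z₀ hz₀)).trans (le_of_eq ?_)
    have hgeom := geom_sum_mul (1 + κ * m) l
    congr 1
    linear_combination κt * Real.exp r * hgeom

end Parameter

/-! ### Hypocoercivity: the modified entropy -/

section Hypocoercivity
variable {H : Type*} [NormedAddCommGroup H] [InnerProductSpace ℝ H]

theorem isClosed_compBounded {T : H →ₗ.[ℝ] H} (hT : T.IsClosed) (P : H →L[ℝ] H) :
    (compBounded T P).IsClosed := by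
  have h : ((compBounded T P).graph : Set (H × H))
      = (fun p : H × H => (P p.1, p.2)) ⁻¹' T.graph := by
    ext ⟨x, y⟩
    simp only [SetLike.mem_coe, LinearPMap.mem_graph_iff, mem_preimage]
    constructor
    · rintro ⟨k, rfl, rfl⟩
      exact ⟨⟨P k, k.2⟩, rfl, rfl⟩
    · rintro ⟨k, hk, rfl⟩
      have hx : P x ∈ T.domain := hk ▸ k.2
      exact ⟨⟨x, hx⟩, rfl, congrArg T (Subtype.ext hk.symm)⟩
  rw [LinearPMap.IsClosed, h]
  exact IsClosed.preimage (by fun_prop) hT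

/-- The abstract form of the properties of the transport operator `T`, the projection `P` onto
local equilibria and the normalized global equilibrium `e`. -/
structure IsMacroscopic (T : H →ₗ.[ℝ] H) (P : H →L[ℝ] H) (e : H) (β : ℝ) : Prop where
  closed : T.IsClosed
  skew_symmetric : ∀ f g : T.domain, ⟪T f, (g : H)⟫_ℝ = -⟪(f : H), T g⟫_ℝ
  core : T.HasCore (T.domain ⊓ T.domain.comap P.toLinearMap)
  proj_symmetric : ∀ f g, ⟪P f, g⟫_ℝ = ⟪f, P g⟫_ℝ
  proj_idem : ∀ f, P (P f) = P f
  norm_eq_one : ‖e‖ = 1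
  proj_apply : P e = e
  transport_apply : ∃ h : e ∈ T.domain, T ⟨e, h⟩ = 0
  coercive : ∀ f, ⟪f, e⟫_ℝ = 0 → ∀ h : P f ∈ T.domain, β * ‖P f‖ ^ 2 ≤ ‖T ⟨P f, h⟩‖ ^ 2
  orthogonality : ∀ f, ∀ h : P f ∈ T.domain, P (T ⟨P f, h⟩) = 0

variable {T : H →ₗ.[ℝ] H} {P : H →L[ℝ] H} {e : H} {β : ℝ}

namespace IsMacroscopic

theorem norm_sq_eq (hM : IsMacroscopic T P e β) (f : H) :
    ‖f‖ ^ 2 = ‖P f‖ ^ 2 + ‖f - P f‖ ^ 2 := by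
  have h0 : ⟪P f, f - P f⟫_ℝ = 0 := by
    rw [hM.proj_symmetric, map_sub, hM.proj_idem, sub_self, inner_zero_right]
  have h := norm_add_sq_real (P f) (f - P f)
  rw [add_sub_cancel, h0] at h
  linarith

/-- Inequalities that are closed in the graph norm extend from `D(T) ∩ D(T P)` to `D(T)`. -/
theorem graph_subset (hM : IsMacroscopic T P e β) {K : Set (H × H)} (hK : IsClosed K)
    (h : ∀ (x : H) (hx : x ∈ T.domain), P x ∈ T.domain → (x, T ⟨x, hx⟩) ∈ K) (f : T.domain) :
    ((f : H), T f) ∈ K := by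
  set S := T.domain ⊓ T.domain.comap P.toLinearMap with hS
  have hsub : ((T.domRestrict S).graph : Set (H × H)) ⊆ K := by
    rintro ⟨x, y⟩ hxy
    rw [SetLike.mem_coe, LinearPMap.mem_graph_iff] at hxy
    obtain ⟨k, hk1, hk2⟩ := hxy
    have hkS : (k : H) ∈ S := k.2.1
    simp only at hk1 hk2
    rw [hk1] at hkS
    have hy : y = T ⟨x, hkS.1⟩ := by
      rw [← hk2]
      exact LinearPMap.domRestrict_apply (f := T) (y := ⟨x, hkS.1⟩) hk1
    rw [hy]
    exact h x hkS.1 hkS.2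
  have hclb : (T.domRestrict S).IsClosable :=
    hM.closed.isClosable.leIsClosable (LinearPMap.domRestrict_le)
  have h1 : T.graph = (T.domRestrict S).graph.topologicalClosure := by
    rw [hclb.graph_closure_eq_closure_graph, hM.core.closure_eq]
  have hgraph : (T.graph : Set (H × H)) ⊆ K := by
    rw [h1, Submodule.topologicalClosure_coe]
    exact hK.closure_subset_iff.2 hsub
  exact hgraph (LinearPMap.mem_graph T f)

variable [CompleteSpace H]

/-- Variational characterization of `A f`. -/
theorem aux_weak (hM : IsMacroscopic T P e β) (f : H) :
    ∃ h : P (auxOperator (compBounded T P) f) ∈ T.domain, ∀ (k : H) (hk : P k ∈ T.domain),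
      ⟪auxOperator (compBounded T P) f, k⟫_ℝ
        + ⟪T ⟨P (auxOperator (compBounded T P) f), h⟩, T ⟨P k, hk⟩⟫_ℝ = ⟪f, T ⟨P k, hk⟩⟫_ℝ := by
  obtain ⟨h, h1⟩ := auxOperator_weak (isClosed_compBounded hM.closed P) f
  exact ⟨h, fun k hk => h1 ⟨k, hk⟩⟩

theorem proj_aux (hM : IsMacroscopic T P e β) (f : H) :
    P (auxOperator (compBounded T P) f) = auxOperator (compBounded T P) f := by
  obtain ⟨h, h1⟩ := hM.aux_weak f
  set g := auxOperator (compBounded T P) f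
  have hk0 : P (g - P g) = 0 := by rw [map_sub, hM.proj_idem, sub_self]
  have hk : P (g - P g) ∈ T.domain := by rw [hk0]; exact T.domain.zero_mem
  have hTk : T ⟨P (g - P g), hk⟩ = 0 := by
    rw [← LinearPMap.map_zero T]
    exact congrArg T (Subtype.ext hk0)
  have h2 := h1 _ hk
  rw [hTk, inner_zero_right, inner_zero_right, add_zero] at h2
  have h3 : ⟪P g, g - P g⟫_ℝ = 0 := by rw [hM.proj_symmetric, hk0, inner_zero_right]
  have h4 : ⟪g - P g, g - P g⟫_ℝ = 0 := by rw [inner_sub_left, h2, h3, sub_zero]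
  exact (sub_eq_zero.1 (inner_self_eq_zero.1 h4)).symm

/-- `A f` lies in `D(T)`, and `A`, `T A` are controlled by the microscopic part of `f`. -/
theorem aux_bounds (hM : IsMacroscopic T P e β) (f : H) :
    ∃ h : auxOperator (compBounded T P) f ∈ T.domain,
      P (T ⟨auxOperator (compBounded T P) f, h⟩) = 0 ∧
      ‖T ⟨auxOperator (compBounded T P) f, h⟩‖ ≤ ‖f - P f‖ ∧
      ‖auxOperator (compBounded T P) f‖ ≤ 1 / 2 * ‖f - P f‖ := by
  obtain ⟨h, h1⟩ := hM.aux_weak f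
  have hP := hM.proj_aux f
  set g := auxOperator (compBounded T P) f
  have hg : g ∈ T.domain := hP ▸ h
  have hTg : T ⟨P g, h⟩ = T ⟨g, hg⟩ := congrArg T (Subtype.ext hP)
  have hPT : P (T ⟨g, hg⟩) = 0 := by rw [← hTg]; exact hM.orthogonality g h
  have h2 := h1 g h
  rw [hTg, real_inner_self_eq_norm_sq, real_inner_self_eq_norm_sq] at h2
  have h3 : ⟪f, T ⟨g, hg⟩⟫_ℝ = ⟪f - P f, T ⟨g, hg⟩⟫_ℝ := by
    rw [inner_sub_left, hM.proj_symmetric, hPT, inner_zero_right, sub_zero]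
  rw [h3] at h2
  have h4 := real_inner_le_norm (f - P f) (T ⟨g, hg⟩)
  have h5 : ‖T ⟨g, hg⟩‖ ≤ ‖f - P f‖ := by
    by_contra! hlt
    have := norm_nonneg (f - P f)
    nlinarith [sq_nonneg ‖g‖]
  refine ⟨hg, hPT, h5, ?_⟩
  refine abs_le_of_sq_le_sq' ?_ (by positivity) |>.2
  nlinarith [sq_nonneg (‖T ⟨g, hg⟩‖ - 1 / 2 * ‖f - P f‖)]

/-- Coercivity of `A T P`: with `g = A T P f` and `r = P f - g` one has `⟪g, k⟫ = ⟪T r, T k⟫` for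
all macroscopic `k`, so that `⟪g, r⟫ = ‖T r‖² ≥ β ‖r‖²`. -/
theorem aux_transport_proj_coercive (hM : IsMacroscopic T P e β) (hβ : 0 < β) {f : H}
    (hfe : ⟪f, e⟫_ℝ = 0) (hf : P f ∈ T.domain) :
    β / (1 + β) * ‖P f‖ ^ 2 ≤ ⟪auxOperator (compBounded T P) (T ⟨P f, hf⟩), P f⟫_ℝ := by
  obtain ⟨h, h1⟩ := hM.aux_weak (T ⟨P f, hf⟩)
  have hP := hM.proj_aux (T ⟨P f, hf⟩)
  set g := auxOperator (compBounded T P) (T ⟨P f, hf⟩)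
  set r := P f - g with hr
  have hPr : P r = r := by rw [hr, map_sub, hM.proj_idem, hP]
  have hrd : P r ∈ T.domain := by
    rw [hPr, hr]
    exact T.domain.sub_mem hf (hP ▸ h)
  have hTr : T ⟨P r, hrd⟩ = T ⟨P f, hf⟩ - T ⟨P g, h⟩ := by
    rw [← LinearPMap.map_sub]
    exact congrArg T (Subtype.ext (by
      change P r = P f - P g
      rw [hPr, hP]))
  have key : ∀ (k : H) (hk : P k ∈ T.domain), ⟪g, k⟫_ℝ = ⟪T ⟨P r, hrd⟩, T ⟨P k, hk⟩⟫_ℝ := by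
    intro k hk
    rw [hTr, inner_sub_left]
    linarith [h1 k hk]
  obtain ⟨hed, hTe⟩ := hM.transport_apply
  have hge : ⟪g, e⟫_ℝ = 0 := by
    have hed' : P e ∈ T.domain := by rw [hM.proj_apply]; exact hed
    have hTe' : T ⟨P e, hed'⟩ = 0 := by
      rw [← hTe]; exact congrArg T (Subtype.ext hM.proj_apply)
    rw [key e hed', hTe', inner_zero_right]
  have hre : ⟪r, e⟫_ℝ = 0 := by
    rw [hr, inner_sub_left, hge, hM.proj_symmetric, hM.proj_apply, hfe, sub_zero]
  have h2 := hM.coercive r hre hrd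
  have h3 := key r hrd
  rw [real_inner_self_eq_norm_sq] at h3
  have hnr : ‖P r‖ = ‖r‖ := by rw [hPr]
  rw [hnr] at h2
  have h4 := real_inner_le_norm g r
  have hPf : P f = g + r := by rw [hr]; abel
  have h5 : ‖P f‖ ^ 2 = ‖g‖ ^ 2 + 2 * ⟪g, r⟫_ℝ + ‖r‖ ^ 2 := by rw [hPf, norm_add_sq_real]
  have h6 : ⟪g, P f⟫_ℝ = ‖g‖ ^ 2 + ⟪g, r⟫_ℝ := by
    rw [hPf, inner_add_right, real_inner_self_eq_norm_sq]
  have h7 : β * ‖r‖ ^ 2 ≤ ⟪g, r⟫_ℝ := by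
    linarith
  rw [h5, h6, div_mul_eq_mul_div, div_le_iff₀ (by linarith)]
  -- it remains to see `β ⟪g, r⟫ ≤ ‖g‖²`, which follows from `β ‖r‖ ≤ ‖g‖`
  have h8 : β * ⟪g, r⟫_ℝ ≤ ‖g‖ ^ 2 := by
    have h9 : β * ‖r‖ ≤ ‖g‖ := by
      rcases (norm_nonneg r).eq_or_lt with h0 | h0
      · rw [← h0, mul_zero]; exact norm_nonneg g
      · have : β * ‖r‖ * ‖r‖ ≤ ‖g‖ * ‖r‖ := by nlinarith
        exact le_of_mul_le_mul_right this h0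
    calc β * ⟪g, r⟫_ℝ ≤ β * (‖g‖ * ‖r‖) := by gcongr
      _ = ‖g‖ * (β * ‖r‖) := by ring
      _ ≤ ‖g‖ * ‖g‖ := by gcongr
      _ = ‖g‖ ^ 2 := by ring
  nlinarith

/-- Macroscopic dissipation on all of `D(T)`. On the core, `T f = T P f + T (1 - P) f`; the
inequality is preserved by limits in the graph norm. -/
theorem inner_aux_transport_ge (hM : IsMacroscopic T P e β) (hβ : 0 < β) {γ : ℝ}
    (hγ : ∀ f, ∀ h : f - P f ∈ T.domain,
      ‖auxOperator (compBounded T P) (T ⟨f - P f, h⟩)‖ ≤ γ * ‖f - P f‖)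
    (f : T.domain) (hfe : ⟪(f : H), e⟫_ℝ = 0) :
    β / (1 + β) * ‖P f‖ ^ 2 - γ * ‖(f : H) - P f‖ * ‖P f‖
      ≤ ⟪auxOperator (compBounded T P) (T f), (f : H)⟫_ℝ := by
  set A := auxOperator (compBounded T P) with hA
  obtain ⟨hed, hTe⟩ := hM.transport_apply
  set 𝒞 : Set (H × H) := {p | β / (1 + β) * ‖P (p.1 - ⟪p.1, e⟫_ℝ • e)‖ ^ 2
    - γ * ‖(p.1 - ⟪p.1, e⟫_ℝ • e) - P (p.1 - ⟪p.1, e⟫_ℝ • e)‖ * ‖P (p.1 - ⟪p.1, e⟫_ℝ • e)‖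
      ≤ ⟪A p.2, p.1 - ⟪p.1, e⟫_ℝ • e⟫_ℝ} with h𝒞
  have hclosed : IsClosed 𝒞 := isClosed_le (by fun_prop) (by fun_prop)
  have hmem : ∀ (x : H) (hx : x ∈ T.domain), P x ∈ T.domain → (x, T ⟨x, hx⟩) ∈ 𝒞 := by
    intro x hx hPx
    set x' := x - ⟪x, e⟫_ℝ • e with hx'
    have hee : ⟪e, e⟫_ℝ = 1 := by rw [real_inner_self_eq_norm_sq, hM.norm_eq_one, one_pow]
    have hx'e : ⟪x', e⟫_ℝ = 0 := by
      rw [hx', inner_sub_left, inner_smul_left, hee]; simp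
    have hd : x' ∈ T.domain := T.domain.sub_mem hx (T.domain.smul_mem _ hed)
    have hPx' : P x' = P x - ⟪x, e⟫_ℝ • e := by rw [hx', map_sub, map_smul, hM.proj_apply]
    have hPd : P x' ∈ T.domain := by
      rw [hPx']; exact T.domain.sub_mem hPx (T.domain.smul_mem _ hed)
    have hTx' : T ⟨x', hd⟩ = T ⟨x, hx⟩ := by
      have h1 : (⟨x', hd⟩ : T.domain) = ⟨x, hx⟩ - ⟪x, e⟫_ℝ • ⟨e, hed⟩ := Subtype.ext rfl
      rw [h1, LinearPMap.map_sub, LinearPMap.map_smul, hTe, smul_zero, sub_zero]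
    have hmd : x' - P x' ∈ T.domain := T.domain.sub_mem hd hPd
    have hsplit : T ⟨x, hx⟩ = T ⟨P x', hPd⟩ + T ⟨x' - P x', hmd⟩ := by
      rw [← hTx', ← LinearPMap.map_add]
      exact congrArg T (Subtype.ext (add_sub_cancel (P x') x').symm)
    have hPA : ∀ v, ⟪A v, x'⟫_ℝ = ⟪A v, P x'⟫_ℝ := fun v => by
      rw [← hM.proj_symmetric, hM.proj_aux]
    change β / (1 + β) * ‖P x'‖ ^ 2 - γ * ‖x' - P x'‖ * ‖P x'‖ ≤ ⟪A (T ⟨x, hx⟩), x'⟫_ℝ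
    rw [hPA, hsplit, map_add, inner_add_left]
    have h1 := hM.aux_transport_proj_coercive hβ hx'e hPd
    have h2 := hγ x' hmd
    have h3 := (abs_le.1 (abs_real_inner_le_norm (A (T ⟨x' - P x', hmd⟩)) (P x'))).1
    have h4 := mul_le_mul_of_nonneg_right h2 (norm_nonneg (P x'))
    linarith
  have := hM.graph_subset hclosed hmem f
  simp only [h𝒞, mem_ofPred_eq, hfe, zero_smul, sub_zero] at this
  exact this

/-- The modified entropy `‖f‖² + 2 ε ⟪A f, f⟫` yields exponential decay, with a rate depending on
`α`, `β`, `γ` only. -/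
theorem exists_isEnergyForm (hM : IsMacroscopic T P e β) (hβ : 0 < β) {α γ : ℝ} (hα : 0 < α) :
    ∃ lam a C : ℝ, 0 < lam ∧ 0 < a ∧ 2 ≤ C ∧ ∀ B : H →L[ℝ] H,
      (∀ f g, ⟪B f, g⟫_ℝ = ⟪f, B g⟫_ℝ) → (∀ f, B (P f) = 0) →
      (∀ f, α * ‖f - P f‖ ^ 2 ≤ -⟪B f, f⟫_ℝ) →
      (∀ f, ∀ h : f - P f ∈ T.domain, ‖auxOperator (compBounded T P) (T ⟨f - P f, h⟩)‖
        + ‖auxOperator (compBounded T P) (B f)‖ ≤ γ * ‖f - P f‖) →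
      ∃ G, IsEnergyForm T e B G (-lam) a C := by
  set κ := β / (1 + β) with hκ
  have hκ0 : 0 < κ := by positivity
  -- `ε` is so small that the errors of order `ε ‖(1 - P) f‖²` are absorbed by half of the
  -- microscopic dissipation, and the modified entropy stays comparable to the squared norm
  set ε := min (1 / 2) (α / 2 / (1 + 2 * γ ^ 2 / κ)) with hε
  have hden : 0 < 1 + 2 * γ ^ 2 / κ := by positivity
  have hε0 : 0 < ε := by positivity
  have hε1 : ε ≤ 1 / 2 := min_le_left _ _
  have hε2 : ε * (1 + 2 * γ ^ 2 / κ) ≤ α / 2 := by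
    rw [← le_div_iff₀ hden]; exact min_le_right _ _
  set c := min (α / 2) (ε * κ / 2) with hc
  have hc0 : 0 < c := by positivity
  have hc1 : c ≤ α / 2 := min_le_left _ _
  have hc2 : c ≤ ε * κ / 2 := min_le_right _ _
  refine ⟨c / 8, c / 2, 4 / c + 2, by positivity, by positivity,
    by linarith [div_pos (by norm_num : (0 : ℝ) < 4) hc0], fun B hBs hBP hBm hBa => ?_⟩
  set A := auxOperator (compBounded T P) with hA
  have hA2 : ∀ x, ‖A x‖ ≤ 1 / 2 * ‖x‖ := by
    intro x
    obtain ⟨-, -, -, h⟩ := hM.aux_bounds x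
    have h1 : ‖x - P x‖ ≤ ‖x‖ :=
      abs_le_of_sq_le_sq' (by nlinarith [hM.norm_sq_eq x, sq_nonneg ‖P x‖]) (norm_nonneg _) |>.2
    linarith
  have hAx : ∀ x y, |⟪A x, y⟫_ℝ| ≤ 1 / 2 * ‖x‖ * ‖y‖ := fun x y =>
    (abs_real_inner_le_norm _ _).trans (mul_le_mul_of_nonneg_right (hA2 x) (norm_nonneg y))
  set G : H →L[ℝ] H := ContinuousLinearMap.id ℝ H + ε • (A + ContinuousLinearMap.adjoint A)
    with hG
  have hGin : ∀ x y, ⟪G x, y⟫_ℝ = ⟪x, y⟫_ℝ + ε * (⟪A x, y⟫_ℝ + ⟪A y, x⟫_ℝ) := by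
    intro x y
    have h : G x = x + ε • (A x + ContinuousLinearMap.adjoint A x) := rfl
    rw [h, inner_add_left, inner_smul_left, inner_add_left,
      ContinuousLinearMap.adjoint_inner_left, real_inner_comm (A y) x]
    rfl
  have hGx : ∀ x, ⟪G x, x⟫_ℝ = ‖x‖ ^ 2 + 2 * ε * ⟪A x, x⟫_ℝ := by
    intro x
    rw [hGin, real_inner_self_eq_norm_sq]
    ring
  have hGbound : ∀ x, |2 * ε * ⟪A x, x⟫_ℝ| ≤ 1 / 2 * ‖x‖ ^ 2 := by
    intro x
    rw [abs_mul, abs_of_pos (by positivity : 0 < 2 * ε)]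
    calc 2 * ε * |⟪A x, x⟫_ℝ| ≤ 2 * (1 / 2) * (1 / 2 * ‖x‖ * ‖x‖) := by
          gcongr
          exact hAx x x
      _ = _ := by ring
  refine ⟨G, ⟨fun x y => ?_, fun x => ?_, fun x => ?_, fun x s hxe hse => ?_⟩⟩
  · rw [hGin, real_inner_comm (G y) x, hGin y x, real_inner_comm y x]
    ring
  · rw [hGx]
    linarith [(abs_le.1 (hGbound x)).1]
  · rw [hGx]
    linarith [(abs_le.1 (hGbound x)).2, sq_nonneg ‖(x : H)‖]
  · -- the five contributions to the derivative of the modified entropy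
    set p := ‖(x : H) - P x‖ with hp
    set q := ‖P (x : H)‖ with hq
    have hnorm : ‖(x : H)‖ ^ 2 = q ^ 2 + p ^ 2 := hM.norm_sq_eq x
    have hPA : ∀ v, ⟪A v, (x : H)⟫_ℝ = ⟪A v, P x⟫_ℝ := fun v => by
      rw [← hM.proj_symmetric, hM.proj_aux]
    have t0 : ⟪(x : H), T x⟫_ℝ = 0 := by
      have := hM.skew_symmetric x x
      rw [real_inner_comm] at this
      linarith
    have t1 : α * p ^ 2 ≤ -⟪B x, (x : H)⟫_ℝ := hBm x
    have t2 : κ * q ^ 2 - γ * p * q ≤ ⟪A (T x), (x : H)⟫_ℝ :=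
      hM.inner_aux_transport_ge hβ
        (fun f h => (le_add_of_nonneg_right (norm_nonneg _)).trans (hBa f h)) x hxe
    have t3 : ⟪A (B x), (x : H)⟫_ℝ ≤ γ * p * q := by
      have h1 : ‖A (B x)‖ ≤ γ * p := by
        have hK : IsClosed {y : H × H | ‖A (B y.1)‖ ≤ γ * ‖y.1 - P y.1‖} :=
          isClosed_le (by fun_prop) (by fun_prop)
        exact hM.graph_subset hK (fun y hy hPy =>
          (le_add_of_nonneg_left (norm_nonneg _)).trans (hBa y (T.domain.sub_mem hy hPy))) x
      rw [hPA]
      exact (real_inner_le_norm _ _).trans (mul_le_mul_of_nonneg_right h1 (norm_nonneg _))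
    have t4 : -p ^ 2 ≤ ⟪A x, T x⟫_ℝ := by
      obtain ⟨hd, h1, h2, -⟩ := hM.aux_bounds (x : H)
      have h3 := hM.skew_symmetric ⟨A x, hd⟩ x
      have h4 : ⟪T ⟨A x, hd⟩, (x : H)⟫_ℝ = ⟪T ⟨A x, hd⟩, (x : H) - P x⟫_ℝ := by
        rw [inner_sub_right, ← hM.proj_symmetric, h1, inner_zero_left, sub_zero]
      have h5 := real_inner_le_norm (T ⟨A x, hd⟩) ((x : H) - P x)
      have h6 : ‖T ⟨A x, hd⟩‖ * ‖(x : H) - P x‖ ≤ p * p :=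
        mul_le_mul_of_nonneg_right h2 (norm_nonneg _)
      simp only at h3
      nlinarith
    have t5 : ⟪A x, B x⟫_ℝ = 0 := by
      rw [← hBs, ← hM.proj_aux, hBP, inner_zero_left]
    have hmain : c * ‖(x : H)‖ ^ 2 ≤ -⟪B x, (x : H)⟫_ℝ
        + ε * (⟪A (T x), (x : H)⟫_ℝ - ⟪A (B x), (x : H)⟫_ℝ + ⟪A x, T x⟫_ℝ) := by
      have hsum : κ * q ^ 2 - 2 * (γ * p * q) - p ^ 2
          ≤ ⟪A (T x), (x : H)⟫_ℝ - ⟪A (B x), (x : H)⟫_ℝ + ⟪A x, T x⟫_ℝ := by linarith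
      have hyoung : 2 * (γ * p * q) ≤ κ * q ^ 2 / 2 + 2 * γ ^ 2 / κ * p ^ 2 := by
        have h : κ * q ^ 2 / 2 + 2 * γ ^ 2 / κ * p ^ 2 - 2 * (γ * p * q)
            = (κ * q - 2 * γ * p) ^ 2 / (2 * κ) := by
          field_simp
          ring
        have : 0 ≤ (κ * q - 2 * γ * p) ^ 2 / (2 * κ) := by positivity
        linarith
      have h1 : ε * (κ * q ^ 2 / 2 - (1 + 2 * γ ^ 2 / κ) * p ^ 2)
          ≤ ε * (⟪A (T x), (x : H)⟫_ℝ - ⟪A (B x), (x : H)⟫_ℝ + ⟪A x, T x⟫_ℝ) := by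
        gcongr
        linarith
      rw [hnorm]
      nlinarith [mul_le_mul_of_nonneg_right hε2 (sq_nonneg p),
        mul_le_mul_of_nonneg_right hc1 (sq_nonneg p), mul_le_mul_of_nonneg_right hc2 (sq_nonneg q)]
    have hexpand : ⟪G x, -T x + B x + s⟫_ℝ = ⟪B x, (x : H)⟫_ℝ
        - ε * (⟪A (T x), (x : H)⟫_ℝ - ⟪A (B x), (x : H)⟫_ℝ + ⟪A x, T x⟫_ℝ)
        + (⟪(x : H), s⟫_ℝ + ε * (⟪A x, s⟫_ℝ + ⟪A s, (x : H)⟫_ℝ)) := by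
      rw [hGin]
      simp only [inner_add_right, inner_neg_right, map_add, map_neg, inner_add_left,
        inner_neg_left, t0, t5]
      rw [real_inner_comm (x : H) (B x)]
      ring
    have hs : ⟪(x : H), s⟫_ℝ + ε * (⟪A x, s⟫_ℝ + ⟪A s, (x : H)⟫_ℝ) ≤ 2 * (‖(x : H)‖ * ‖s‖) := by
      have h1 := real_inner_le_norm (x : H) s
      have h2 := (abs_le.1 (hAx x s)).2
      have h3 := (abs_le.1 (hAx s x)).2
      have h4 : ⟪A x, s⟫_ℝ + ⟪A s, (x : H)⟫_ℝ ≤ ‖(x : H)‖ * ‖s‖ := by linarith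
      have h5 := mul_nonneg (norm_nonneg (x : H)) (norm_nonneg s)
      nlinarith
    have hy : 4 * (‖(x : H)‖ * ‖s‖) ≤ c * ‖(x : H)‖ ^ 2 + 4 / c * ‖s‖ ^ 2 := by
      have h : c * ‖(x : H)‖ ^ 2 + 4 / c * ‖s‖ ^ 2 - 4 * (‖(x : H)‖ * ‖s‖)
          = (c * ‖(x : H)‖ - 2 * ‖s‖) ^ 2 / c := by
        field_simp
        ring
      have : 0 ≤ (c * ‖(x : H)‖ - 2 * ‖s‖) ^ 2 / c := by positivity
      linarith
    have hup : ⟪G x, (x : H)⟫_ℝ ≤ 2 * ‖(x : H)‖ ^ 2 := by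
      rw [hGx]
      linarith [(abs_le.1 (hGbound x)).2, sq_nonneg ‖(x : H)‖]
    have hcup := mul_le_mul_of_nonneg_left hup hc0.le
    rw [hexpand]
    linarith [sq_nonneg ‖s‖]

end IsMacroscopic
end Hypocoercivity

/-! ### Multiplication operators depending smoothly on a parameter -/

section Multiplication
variable {d : ℕ} {F : Phase d → ℝ}

/-- Bounded and measurable functions of the position. -/
structure IsBoundedMeasurable (q : Pos d → ℝ) : Prop where
  measurable : Measurable q
  bounded : ∃ C, ∀ x, |q x| ≤ C

namespace IsBoundedMeasurable
variable {q q₁ q₂ : Pos d → ℝ}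

theorem mulPos_ae_eq (hq : IsBoundedMeasurable q) (f : KSpace F) :
    mulPos F q f =ᵐ[weight F] fun p => q p.1 * f p :=
  Kinetic.mulPos_ae_eq F hq.measurable hq.bounded.choose_spec f

theorem add (h₁ : IsBoundedMeasurable q₁) (h₂ : IsBoundedMeasurable q₂) :
    IsBoundedMeasurable fun x => q₁ x + q₂ x := by
  obtain ⟨C₁, hC₁⟩ := h₁.bounded
  obtain ⟨C₂, hC₂⟩ := h₂.bounded
  exact ⟨h₁.measurable.add h₂.measurable,
    C₁ + C₂, fun x => (abs_add_le _ _).trans (add_le_add (hC₁ x) (hC₂ x))⟩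

theorem const_mul (h : IsBoundedMeasurable q) (c : ℝ) : IsBoundedMeasurable fun x => c * q x := by
  obtain ⟨C, hC⟩ := h.bounded
  refine ⟨h.measurable.const_mul c, |c| * C, fun x => ?_⟩
  rw [abs_mul]
  exact mul_le_mul_of_nonneg_left (hC x) (abs_nonneg c)

end IsBoundedMeasurable

theorem norm_mulPos_le {q : Pos d → ℝ} (hq : Measurable q) {C : ℝ} (hC : ∀ x, |q x| ≤ C)
    (f : KSpace F) : ‖mulPos F q f‖ ≤ C * ‖f‖ := by
  refine Lp.norm_le_mul_norm_of_ae_le_mul ?_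
  filter_upwards [mulPos_ae_eq F hq hC f] with p hp
  rw [hp, norm_mul]
  exact mul_le_mul_of_nonneg_right (hC p.1) (norm_nonneg _)

open Classical in
/-- The bounded operator of multiplication by a bounded measurable function of the position; zero
by convention if the function is not bounded and measurable. -/
def mulOp (F : Phase d → ℝ) (q : Pos d → ℝ) : KSpace F →L[ℝ] KSpace F :=
  if h : IsBoundedMeasurable q then
    LinearMap.mkContinuous
      { toFun := mulPos F q
        map_add' := fun f g => by
          refine Lp.ext ?_
          filter_upwards [h.mulPos_ae_eq (f + g), h.mulPos_ae_eq f, h.mulPos_ae_eq g,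
            Lp.coeFn_add f g, Lp.coeFn_add (mulPos F q f) (mulPos F q g)] with p h1 h2 h3 h4 h5
          rw [h1, h4, h5, Pi.add_apply, Pi.add_apply, h2, h3, mul_add]
        map_smul' := fun c f => by
          refine Lp.ext ?_
          filter_upwards [h.mulPos_ae_eq (c • f), h.mulPos_ae_eq f, Lp.coeFn_smul c f,
            Lp.coeFn_smul c (mulPos F q f)] with p h1 h2 h4 h5
          rw [RingHom.id_apply, h1, h4, h5, Pi.smul_apply, Pi.smul_apply, h2, smul_eq_mul,
            smul_eq_mul]
          ring }
      h.bounded.choose (norm_mulPos_le h.measurable h.bounded.choose_spec)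
  else 0

theorem mulOp_apply {q : Pos d → ℝ} (hq : IsBoundedMeasurable q) (f : KSpace F) :
    mulOp F q f = mulPos F q f := by
  rw [mulOp, dif_pos hq]
  rfl

theorem mulOp_add {q₁ q₂ : Pos d → ℝ} (h₁ : IsBoundedMeasurable q₁)
    (h₂ : IsBoundedMeasurable q₂) :
    mulOp F (fun x => q₁ x + q₂ x) = mulOp F q₁ + mulOp F q₂ := by
  refine ContinuousLinearMap.ext fun f => ?_
  rw [add_apply, mulOp_apply (h₁.add h₂), mulOp_apply h₁, mulOp_apply h₂]
  refine Lp.ext ?_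
  filter_upwards [(h₁.add h₂).mulPos_ae_eq f, h₁.mulPos_ae_eq f, h₂.mulPos_ae_eq f,
    Lp.coeFn_add (mulPos F q₁ f) (mulPos F q₂ f)] with p e1 e2 e3 e4
  rw [e1, e4, Pi.add_apply, e2, e3, add_mul]

theorem mulOp_const_mul {q : Pos d → ℝ} (h : IsBoundedMeasurable q) (c : ℝ) :
    mulOp F (fun x => c * q x) = c • mulOp F q := by
  refine ContinuousLinearMap.ext fun f => ?_
  rw [smul_apply, mulOp_apply (h.const_mul c), mulOp_apply h]
  refine Lp.ext ?_
  filter_upwards [(h.const_mul c).mulPos_ae_eq f, h.mulPos_ae_eq f,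
    Lp.coeFn_smul c (mulPos F q f)] with p e1 e2 e3
  rw [e1, e3, Pi.smul_apply, e2, smul_eq_mul, mul_assoc]

theorem mulOp_sub {q₁ q₂ : Pos d → ℝ} (h₁ : IsBoundedMeasurable q₁)
    (h₂ : IsBoundedMeasurable q₂) :
    mulOp F (fun x => q₁ x - q₂ x) = mulOp F q₁ - mulOp F q₂ := by
  have h := mulOp_add (F := F) h₁ (h₂.const_mul (-1))
  rw [mulOp_const_mul h₂] at h
  simpa [sub_eq_add_neg] using h

theorem norm_mulOp_le {q : Pos d → ℝ} (hq : Measurable q) {C : ℝ} (hC : ∀ x, |q x| ≤ C) :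
    ‖mulOp F q‖ ≤ C := by
  refine ContinuousLinearMap.opNorm_le_bound _ ((abs_nonneg _).trans (hC 0)) fun f => ?_
  rw [mulOp_apply ⟨hq, C, hC⟩]
  exact norm_mulPos_le hq hC f

variable {Z : Type*} [NormedAddCommGroup Z] [NormedSpace ℝ Z]

/-- Families of multilinear forms, bounded and measurable in the position. -/
structure IsBoundedMeasurableFamily {l : ℕ} (Φ : Pos d → Z [×l]→L[ℝ] ℝ) : Prop where
  measurable : ∀ v, Measurable fun x => Φ x v
  bounded : ∃ C, ∀ x, ‖Φ x‖ ≤ C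

theorem abs_apply_le {l : ℕ} {Φ : Pos d → Z [×l]→L[ℝ] ℝ} {C : ℝ} (hC : ∀ x, ‖Φ x‖ ≤ C)
    (v : Fin l → Z) (x : Pos d) : |Φ x v| ≤ C * ∏ i, ‖v i‖ :=
  ((Φ x).le_opNorm v).trans
    (mul_le_mul_of_nonneg_right (hC x) (Finset.prod_nonneg fun _ _ => norm_nonneg _))

theorem IsBoundedMeasurableFamily.apply {l : ℕ} {Φ : Pos d → Z [×l]→L[ℝ] ℝ}
    (h : IsBoundedMeasurableFamily Φ) (v : Fin l → Z) : IsBoundedMeasurable fun x => Φ x v := by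
  obtain ⟨C, hC⟩ := h.bounded
  exact ⟨h.measurable v, _, abs_apply_le hC v⟩

open Classical in
/-- The multilinear map `v ↦` multiplication by `x ↦ Φ x v`, with values in the bounded operators;
zero by convention if the family is not bounded and measurable. -/
def mulMultilinear (F : Phase d → ℝ) {l : ℕ} (Φ : Pos d → Z [×l]→L[ℝ] ℝ) :
    Z [×l]→L[ℝ] (KSpace F →L[ℝ] KSpace F) :=
  if h : IsBoundedMeasurableFamily Φ then
    MultilinearMap.mkContinuous
      { toFun := fun v => mulOp F fun x => Φ x v
        map_update_add' := fun v i a b => by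
          rw [← mulOp_add (h.apply _) (h.apply _)]
          congr 1
          funext x
          convert (Φ x).map_update_add v i a b
        map_update_smul' := fun v i c a => by
          rw [← mulOp_const_mul (h.apply _)]
          congr 1
          funext x
          rw [← smul_eq_mul]
          convert (Φ x).map_update_smul v i c a }
      h.bounded.choose
      fun v => norm_mulOp_le (h.measurable v) (abs_apply_le h.bounded.choose_spec v)
  else 0

theorem mulMultilinear_apply {l : ℕ} {Φ : Pos d → Z [×l]→L[ℝ] ℝ}
    (h : IsBoundedMeasurableFamily Φ) (v : Fin l → Z) :
    mulMultilinear F Φ v = mulOp F fun x => Φ x v := by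
  rw [mulMultilinear, dif_pos h]
  rfl

theorem norm_mulMultilinear_le {l : ℕ} {Φ : Pos d → Z [×l]→L[ℝ] ℝ}
    (h : IsBoundedMeasurableFamily Φ) {C : ℝ} (hC : ∀ x, ‖Φ x‖ ≤ C) :
    ‖mulMultilinear F Φ‖ ≤ C := by
  refine ContinuousMultilinearMap.opNorm_le_bound ((norm_nonneg _).trans (hC 0)) fun v => ?_
  rw [mulMultilinear_apply h]
  exact norm_mulOp_le (h.measurable v) (abs_apply_le hC v)

variable {Ω : Set Z} {σ : Pos d → Z → ℝ}

theorem hasFDerivWithinAt_iteratedFDerivWithin (hu : UniqueDiffOn ℝ Ω) {g : Z → ℝ}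
    (hg : ContDiffOn ℝ ∞ g Ω) (l : ℕ) {z : Z} (hz : z ∈ Ω) :
    HasFDerivWithinAt (iteratedFDerivWithin ℝ l g Ω)
      (iteratedFDerivWithin ℝ (l + 1) g Ω z).curryLeft Ω z :=
  (hg.ftaylorSeriesWithin hu).fderivWithin l (by exact_mod_cast WithTop.coe_lt_top _) z hz

/-- The derivatives of `σ` in the parameter are measurable in the position: difference quotients
give the derivatives in the directions `y - z` with `y ∈ Ω`, and these span. -/
theorem measurable_iteratedFDerivWithin (hΩ : Convex ℝ Ω) (hΩ' : (interior Ω).Nonempty)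
    (hm : ∀ z ∈ Ω, Measurable fun x => σ x z) (hs : ∀ x, ContDiffOn ℝ ∞ (σ x) Ω) (l : ℕ) :
    ∀ z ∈ Ω, ∀ v, Measurable fun x => iteratedFDerivWithin ℝ l (σ x) Ω z v := by
  have hu : UniqueDiffOn ℝ Ω := uniqueDiffOn_convex hΩ hΩ'
  induction l with
  | zero =>
    intro z hz v
    simpa only [iteratedFDerivWithin_zero_apply] using hm z hz
  | succ l ih =>
    intro z hz v
    have hdir : ∀ y ∈ Ω, Measurable fun x =>
        (iteratedFDerivWithin ℝ (l + 1) (σ x) Ω z).curryLeft (y - z) (Fin.tail v) := by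
      intro y hy
      have hmem : ∀ n : ℕ, z + ((n : ℝ) + 1)⁻¹ • (y - z) ∈ Ω := by
        intro n
        refine hΩ.add_smul_sub_mem hz hy ⟨by positivity, inv_le_one_of_one_le₀ ?_⟩
        linarith [(Nat.cast_nonneg n : (0 : ℝ) ≤ n)]
      refine measurable_of_tendsto_metrizable (f := fun (n : ℕ) x => ((n : ℝ) + 1) *
        (iteratedFDerivWithin ℝ l (σ x) Ω (z + ((n : ℝ) + 1)⁻¹ • (y - z)) (Fin.tail v)
          - iteratedFDerivWithin ℝ l (σ x) Ω z (Fin.tail v)))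
        (fun n => ((ih _ (hmem n) _).sub (ih z hz _)).const_mul _) ?_
      rw [tendsto_pi_nhds]
      intro x
      have hd : Filter.Tendsto (fun n : ℕ => ((n : ℝ) + 1)⁻¹ • (y - z)) Filter.atTop (nhds 0) := by
        simpa using (tendsto_one_div_add_atTop_nhds_zero_nat (𝕜 := ℝ)).smul_const (y - z)
      have hcd : Filter.Tendsto (fun n : ℕ => ((n : ℝ) + 1) • ((n : ℝ) + 1)⁻¹ • (y - z))
          Filter.atTop (nhds (y - z)) := by
        refine tendsto_const_nhds.congr fun n => ?_
        rw [smul_smul, mul_inv_cancel₀ (by positivity), one_smul]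
      have h1 := (hasFDerivWithinAt_iteratedFDerivWithin hu (hs x) l hz).lim hd
        (Filter.Eventually.of_forall hmem) hcd
      have h2 := ((ContinuousMultilinearMap.apply ℝ (fun _ : Fin l => Z) ℝ
        (Fin.tail v)).continuous.tendsto _).comp h1
      exact h2
    obtain ⟨y, hy⟩ := hΩ'
    have hyΩ : y ∈ Ω := interior_subset hy
    obtain ⟨ε, hε, hmem⟩ : ∃ ε : ℝ, 0 < ε ∧ y + ε • v 0 ∈ Ω := by
      have hc : Continuous fun ε : ℝ => y + ε • v 0 := by fun_prop
      have h0 : ∀ᶠ ε in nhds (0 : ℝ), y + ε • v 0 ∈ interior Ω :=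
        hc.continuousAt.eventually (by simpa using isOpen_interior.mem_nhds hy)
      obtain ⟨ε, h1, h2⟩ := ((h0.filter_mono nhdsWithin_le_nhds).and
        (self_mem_nhdsWithin : Ioi (0 : ℝ) ∈ nhdsWithin 0 (Ioi 0))).exists
      exact ⟨ε, h2, interior_subset h1⟩
    have hv : v 0 = ε⁻¹ • ((y + ε • v 0 - z) - (y - z)) := by
      rw [sub_sub_sub_cancel_right, add_sub_cancel_left, smul_smul, inv_mul_cancel₀ hε.ne',
        one_smul]
    have hfun : (fun x => iteratedFDerivWithin ℝ (l + 1) (σ x) Ω z v) = fun x => ε⁻¹ *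
        ((iteratedFDerivWithin ℝ (l + 1) (σ x) Ω z).curryLeft (y + ε • v 0 - z) (Fin.tail v)
          - (iteratedFDerivWithin ℝ (l + 1) (σ x) Ω z).curryLeft (y - z) (Fin.tail v)) := by
      funext x
      rw [← smul_eq_mul, ← sub_apply, ← smul_apply, ← map_sub, ← map_smul, ← hv,
        ContinuousMultilinearMap.curryLeft_apply, Fin.cons_self_tail]
    rw [hfun]
    exact ((hdir _ hmem).sub (hdir y hyΩ)).const_mul ε⁻¹

theorem isBoundedMeasurableFamily_iteratedFDerivWithin (hΩ : Convex ℝ Ω)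
    (hΩ' : (interior Ω).Nonempty)
    (hm : ∀ z ∈ Ω, Measurable fun x => σ x z) (hs : ∀ x, ContDiffOn ℝ ∞ (σ x) Ω) {C : ℝ}
    (hC : ∀ (l : ℕ) (x : Pos d), ∀ z ∈ Ω,
      ‖iteratedFDerivWithin ℝ l (σ x) Ω z‖ ≤ l.factorial * C) (l : ℕ) {z : Z} (hz : z ∈ Ω) :
    IsBoundedMeasurableFamily fun x => iteratedFDerivWithin ℝ l (σ x) Ω z :=
  ⟨measurable_iteratedFDerivWithin hΩ hΩ' hm hs l z hz, _, fun x => hC l x z hz⟩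

theorem norm_iteratedFDerivWithin_sub_sub_le (hΩ : Convex ℝ Ω) (hu : UniqueDiffOn ℝ Ω)
    {g : Z → ℝ} (hg : ContDiffOn ℝ ∞ g Ω) {C : ℝ} {l : ℕ}
    (hC : ∀ z ∈ Ω, ‖iteratedFDerivWithin ℝ (l + 2) g Ω z‖ ≤ C) {z y : Z} (hz : z ∈ Ω)
    (hy : y ∈ Ω) :
    ‖iteratedFDerivWithin ℝ l g Ω y - iteratedFDerivWithin ℝ l g Ω z
      - (iteratedFDerivWithin ℝ (l + 1) g Ω z).curryLeft (y - z)‖ ≤ C * ‖y - z‖ * ‖y - z‖ := by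
  have hseg : segment ℝ z y ⊆ Ω := hΩ.segment_subset hz hy
  have hC0 : 0 ≤ C := (norm_nonneg _).trans (hC z hz)
  refine Convex.norm_image_sub_le_of_norm_hasFDerivWithin_le' (𝕜 := ℝ) (s := segment ℝ z y)
    (fun w hw => (hasFDerivWithinAt_iteratedFDerivWithin hu hg l (hseg hw)).mono hseg)
    (fun w hw => ?_) (convex_segment z y) (left_mem_segment ℝ z y) (right_mem_segment ℝ z y)
  have h1 : ‖iteratedFDerivWithin ℝ (l + 1) g Ω w - iteratedFDerivWithin ℝ (l + 1) g Ω z‖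
      ≤ C * ‖w - z‖ :=
    hΩ.norm_image_sub_le_of_norm_hasFDerivWithin_le (𝕜 := ℝ)
      (fun x hx => hasFDerivWithinAt_iteratedFDerivWithin hu hg (l + 1) hx)
      (fun x hx => by
        rw [ContinuousMultilinearMap.curryLeft_norm]
        exact hC x hx) hz (hseg hw)
  have h2 : (iteratedFDerivWithin ℝ (l + 1) g Ω w).curryLeft
      - (iteratedFDerivWithin ℝ (l + 1) g Ω z).curryLeft
      = (iteratedFDerivWithin ℝ (l + 1) g Ω w
        - iteratedFDerivWithin ℝ (l + 1) g Ω z).curryLeft := rfl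
  rw [h2, ContinuousMultilinearMap.curryLeft_norm]
  refine h1.trans ?_
  gcongr
  rw [← dist_eq_norm, ← dist_eq_norm]
  obtain ⟨a, ha, rfl⟩ := mem_segment_iff_wbtw.1 hw
  rw [dist_lineMap_left, dist_comm z y, Real.norm_of_nonneg ha.1]
  exact mul_le_of_le_one_left dist_nonneg ha.2

/-- A sequence of multilinear maps satisfying quadratic Taylor estimates is the sequence of
derivatives. -/
theorem hasFTaylorSeriesUpToOn_of_norm_sub_le {V : Type*} [NormedAddCommGroup V]
    [NormedSpace ℝ V] {f : Z → V} {p : Z → FormalMultilinearSeries ℝ Z V} (K : ℕ → ℝ)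
    (h0 : ∀ z ∈ Ω, p z 0 0 = f z)
    (hp : ∀ l : ℕ, ∀ z ∈ Ω, ∀ y ∈ Ω, ∀ v : Fin l → Z,
      ‖p y l v - p z l v - p z (l + 1) (Fin.cons (y - z) v)‖
        ≤ K l * ‖y - z‖ ^ 2 * ∏ i, ‖v i‖) (hK : ∀ l, 0 ≤ K l) :
    HasFTaylorSeriesUpToOn ∞ f p Ω := by
  have hder : ∀ l : ℕ, ∀ z ∈ Ω,
      HasFDerivWithinAt (fun z => p z l) (p z (l + 1)).curryLeft Ω z := by
    intro l z hz
    rw [hasFDerivWithinAt_iff_isLittleO]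
    refine Asymptotics.IsBigO.trans_isLittleO (g := fun y => ‖y - z‖ ^ 2) ?_
      ((Asymptotics.isLittleO_pow_sub_sub z one_lt_two).mono nhdsWithin_le_nhds)
    refine Asymptotics.IsBigO.of_bound (K l) ?_
    filter_upwards [self_mem_nhdsWithin] with y hy
    rw [Real.norm_of_nonneg (by positivity)]
    refine ContinuousMultilinearMap.opNorm_le_bound (mul_nonneg (hK l) (by positivity)) fun v => ?_
    exact hp l z hz y hy v
  refine ⟨fun z hz => h0 z hz, fun l _ z hz => hder l z hz,
    fun l _ z hz => (hder l z hz).continuousWithinAt⟩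

/-- Multiplication by `σ(·, z)` is smooth in `z` in the operator norm, because the derivatives of
`σ` are bounded uniformly in the position. -/
theorem hasFTaylorSeriesUpToOn_mulOp (hΩ : Convex ℝ Ω) (hΩ' : (interior Ω).Nonempty)
    (hm : ∀ z ∈ Ω, Measurable fun x => σ x z) (hs : ∀ x, ContDiffOn ℝ ∞ (σ x) Ω) {C : ℝ}
    (hC : ∀ (l : ℕ) (x : Pos d), ∀ z ∈ Ω,
      ‖iteratedFDerivWithin ℝ l (σ x) Ω z‖ ≤ l.factorial * C) :
    HasFTaylorSeriesUpToOn ∞ (fun z => mulOp F fun x => σ x z)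
      (fun z l => mulMultilinear F fun x => iteratedFDerivWithin ℝ l (σ x) Ω z) Ω := by
  have hu : UniqueDiffOn ℝ Ω := uniqueDiffOn_convex hΩ hΩ'
  have hfam : ∀ (l : ℕ), ∀ z ∈ Ω,
      IsBoundedMeasurableFamily fun x => iteratedFDerivWithin ℝ l (σ x) Ω z := fun l z hz =>
    isBoundedMeasurableFamily_iteratedFDerivWithin hΩ hΩ' hm hs hC l hz
  refine hasFTaylorSeriesUpToOn_of_norm_sub_le (fun l => ((l + 2).factorial : ℝ) * C)
    (fun z hz => ?_) (fun l z hz y hy v => ?_) fun l => ?_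
  · rw [mulMultilinear_apply (hfam 0 z hz)]
    simp only [iteratedFDerivWithin_zero_apply]
  · have h2 : IsBoundedMeasurable fun x => iteratedFDerivWithin ℝ l (σ x) Ω y v
        - iteratedFDerivWithin ℝ l (σ x) Ω z v := by
      simpa [sub_eq_add_neg] using
        ((hfam l y hy).apply v).add (((hfam l z hz).apply v).const_mul (-1))
    rw [mulMultilinear_apply (hfam l y hy), mulMultilinear_apply (hfam l z hz),
      mulMultilinear_apply (hfam (l + 1) z hz),
      ← mulOp_sub ((hfam l y hy).apply v) ((hfam l z hz).apply v),
      ← mulOp_sub h2 ((hfam (l + 1) z hz).apply _)]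
    refine norm_mulOp_le (h2.measurable.sub ((hfam (l + 1) z hz).measurable _)) fun x => ?_
    have h3 := norm_iteratedFDerivWithin_sub_sub_le hΩ hu (hs x) (l := l)
      (fun w hw => hC (l + 2) x w hw) hz hy
    rw [pow_two, ← mul_assoc]
    exact (ContinuousMultilinearMap.le_opNorm (iteratedFDerivWithin ℝ l (σ x) Ω y
      - iteratedFDerivWithin ℝ l (σ x) Ω z
      - (iteratedFDerivWithin ℝ (l + 1) (σ x) Ω z).curryLeft (y - z)) v).trans
      (mul_le_mul_of_nonneg_right h3 (Finset.prod_nonneg fun _ _ => norm_nonneg _))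
  · obtain ⟨z, hz⟩ := hΩ'
    exact (norm_nonneg _).trans (hC (l + 2) 0 z (interior_subset hz))

/-- The random collision operator `σ(·, z) L` is smooth in `z`, with the derivative bounds of
`σ`. -/
theorem contDiffOn_mulOp_comp (hΩ : Convex ℝ Ω) (hΩ' : (interior Ω).Nonempty)
    (hm : ∀ z ∈ Ω, Measurable fun x => σ x z) (hs : ∀ x, ContDiffOn ℝ ∞ (σ x) Ω) {C : ℝ}
    (hC : ∀ (l : ℕ) (x : Pos d), ∀ z ∈ Ω,
      ‖iteratedFDerivWithin ℝ l (σ x) Ω z‖ ≤ l.factorial * C) (L : KSpace F →L[ℝ] KSpace F) :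
    ContDiffOn ℝ ∞ (fun z => (mulOp F fun x => σ x z) ∘L L) Ω ∧
      ∀ l : ℕ, ∀ z ∈ Ω, ‖iteratedFDerivWithin ℝ l (fun z => (mulOp F fun x => σ x z) ∘L L) Ω z‖
        ≤ l.factorial * (C * ‖L‖) := by
  have hu : UniqueDiffOn ℝ Ω := uniqueDiffOn_convex hΩ hΩ'
  have hT := hasFTaylorSeriesUpToOn_mulOp (F := F) hΩ hΩ' hm hs hC
  have hM : ContDiffOn ℝ ∞ (fun z => mulOp F fun x => σ x z) Ω := hT.contDiffOn
  set R : (KSpace F →L[ℝ] KSpace F) →L[ℝ] (KSpace F →L[ℝ] KSpace F) :=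
    (ContinuousLinearMap.compL ℝ (KSpace F) (KSpace F) (KSpace F)).flip L with hR
  have hRn : ‖R‖ ≤ ‖L‖ := by
    refine ContinuousLinearMap.opNorm_le_bound _ (norm_nonneg L) fun A => ?_
    rw [mul_comm]
    exact ContinuousLinearMap.opNorm_comp_le A L
  refine ⟨R.contDiff.comp_contDiffOn hM, fun l z hz => ?_⟩
  have h1 := R.norm_iteratedFDerivWithin_comp_left (hM z hz) hu hz (n := l)
    (by exact_mod_cast le_top)
  have h2 : ‖iteratedFDerivWithin ℝ l (fun z => mulOp F fun x => σ x z) Ω z‖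
      ≤ l.factorial * C := by
    rw [← hT.eq_iteratedFDerivWithin_of_uniqueDiffOn (by exact_mod_cast le_top) hu hz]
    exact norm_mulMultilinear_le
      (isBoundedMeasurableFamily_iteratedFDerivWithin hΩ hΩ' hm hs hC l hz)
      fun x => hC l x z hz
  refine h1.trans ?_
  calc ‖R‖ * ‖iteratedFDerivWithin ℝ l (fun z => mulOp F fun x => σ x z) Ω z‖
      ≤ ‖L‖ * (l.factorial * C) := mul_le_mul hRn h2 (norm_nonneg _) (norm_nonneg _)
    _ = _ := by ring

end Multiplication

/-! ### The kinetic equation in the abstract framework -/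

section Equilibrium
variable {d : ℕ} {F : Phase d → ℝ}

theorem IsEquilibriumDensity.memLp (hF : IsEquilibriumDensity F) : MemLp F 2 (weight F) := by
  rw [memLp_weight_iff hF hF.measurable.aestronglyMeasurable]
  refine hF.integrable.congr (Filter.Eventually.of_forall fun p => ?_)
  have := (hF.pos p).ne'
  field_simp

/-- The global equilibrium `F` as a (unit) vector of `L²(F⁻¹ dx dv)`. -/
def equilibrium (hF : IsEquilibriumDensity F) : KSpace F := hF.memLp.toLp F

theorem coeFn_equilibrium (hF : IsEquilibriumDensity F) :
    equilibrium hF =ᵐ[weight F] F := hF.memLp.coeFn_toLp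

theorem inner_equilibrium (hF : IsEquilibriumDensity F) (f : KSpace F) :
    ⟪f, equilibrium hF⟫_ℝ = mass F f := by
  rw [L2.inner_def, integral_weight hF, mass]
  refine integral_congr_ae ?_
  have h := coeFn_equilibrium hF
  rw [ae_weight_iff hF] at h
  filter_upwards [h] with p hp
  rw [hp]
  have := (hF.pos p).ne'
  simp only [RCLike.inner_apply, conj_trivial]
  field_simp

theorem norm_equilibrium (hF : IsEquilibriumDensity F) : ‖equilibrium hF‖ = 1 := by
  have h : ‖equilibrium hF‖ ^ 2 = 1 := by
    rw [← real_inner_self_eq_norm_sq, inner_equilibrium, mass, ← hF.integral_eq_one]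
    refine integral_congr_ae ?_
    rw [← ae_weight_iff hF]
    exact coeFn_equilibrium hF
  exact (pow_eq_one_iff_of_nonneg (norm_nonneg _) two_ne_zero).1 h

theorem localProj_equilibrium (hF : IsEquilibriumDensity F) :
    localProj F (equilibrium hF) = equilibrium hF := by
  refine Submodule.starProjection_eq_self_iff.2 (Submodule.le_topologicalClosure _ ?_)
  refine ⟨fun _ => 1, measurable_const, ?_⟩
  filter_upwards [coeFn_equilibrium hF] with p hp
  rw [hp, one_mul]

variable {T : KSpace F →ₗ.[ℝ] KSpace F} {L : KSpace F →L[ℝ] KSpace F}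

theorem IsGlobalEquilibrium.apply_equilibrium (hTL : IsGlobalEquilibrium F T L)
    (hF : IsEquilibriumDensity F) : L (equilibrium hF) = 0 ∧
      ∃ h : equilibrium hF ∈ T.domain, T ⟨equilibrium hF, h⟩ = 0 := by
  refine (hTL _).2 ⟨1, ?_⟩
  filter_upwards [coeFn_equilibrium hF] with p hp
  rw [hp, one_mul]

/-- The local equilibria form the kernel of `L`, which is closed, so `Π` takes values in them. -/
theorem IsCollisionOperator.apply_localProj (hL : IsCollisionOperator F L) (f : KSpace F) :
    L (localProj F f) = 0 := by
  have hker : localEquilibria F = L.ker := by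
    ext g
    exact (hL.null_space g).symm
  have hcl : IsClosed (localEquilibria F : Set (KSpace F)) := by
    rw [hker]
    exact L.isClosed_ker
  have h : localProj F f ∈ (localEquilibria F).topologicalClosure :=
    Submodule.starProjection_apply_mem _ _
  rw [hcl.submodule_topologicalClosure_eq] at h
  exact (hL.null_space _).2 h

variable {Lz : KSpace F → KSpace F} {α β γ : ℝ}

theorem Hypocoercive.isMacroscopic (h : Hypocoercive F T Lz α β γ) (hF : IsEquilibriumDensity F)
    (hT : IsTransportOperator F T) (hTL : IsGlobalEquilibrium F T L) :
    IsMacroscopic T (localProj F) (equilibrium hF) β where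
  closed := hT.closed
  skew_symmetric := hT.skew_symmetric
  core := hT.core
  proj_symmetric := Submodule.inner_starProjection_left_eq_right _
  proj_idem f := Submodule.starProjection_eq_self_iff.2 (Submodule.starProjection_apply_mem _ f)
  norm_eq_one := norm_equilibrium hF
  proj_apply := localProj_equilibrium hF
  transport_apply := (hTL.apply_equilibrium hF).2
  coercive f hf := h.macroscopic f ((inner_equilibrium hF f).symm.trans hf)
  orthogonality := h.orthogonality

end Equilibrium

section EnergyForms
variable {H : Type*} [NormedAddCommGroup H] [InnerProductSpace ℝ H]

/-- With a large growth rate `μ` allowed, the squared norm itself is an energy form, whose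
dissipation is as large as desired. -/
theorem isEnergyForm_id {T : H →ₗ.[ℝ] H} {B : H →L[ℝ] H} (e : H)
    (hT : ∀ f g : T.domain, ⟪T f, (g : H)⟫_ℝ = -⟪(f : H), T g⟫_ℝ)
    (hB : ∀ f, ⟪B f, f⟫_ℝ ≤ 0) {μ : ℝ} (hμ : 1 ≤ μ) :
    IsEnergyForm T e B (ContinuousLinearMap.id ℝ H) μ μ 2 where
  symmetric _ _ := rfl
  lower x := by
    rw [ContinuousLinearMap.id_apply, real_inner_self_eq_norm_sq]
    linarith [sq_nonneg ‖x‖]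
  upper x := by
    rw [ContinuousLinearMap.id_apply, real_inner_self_eq_norm_sq]
    linarith [sq_nonneg ‖x‖]
  dissipation x s _ _ := by
    have h0 : ⟪(x : H), T x⟫_ℝ = 0 := by
      have := hT x x
      rw [real_inner_comm] at this
      linarith
    have h1 := hB x
    rw [real_inner_comm] at h1
    have h2 := real_inner_le_norm (x : H) s
    have h3 : 2 * (‖(x : H)‖ * ‖s‖) ≤ ‖(x : H)‖ ^ 2 + ‖s‖ ^ 2 := by
      linarith [two_mul_le_add_sq ‖(x : H)‖ ‖s‖]
    have h4 := mul_le_mul_of_nonneg_right hμ (sq_nonneg ‖(x : H)‖)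
    simp only [ContinuousLinearMap.id_apply, inner_add_right, inner_neg_right, h0,
      real_inner_self_eq_norm_sq]
    linarith [sq_nonneg ‖s‖]

end EnergyForms

section Solutions
variable {H : Type*} [NormedAddCommGroup H] [InnerProductSpace ℝ H]

/-- Conservation of mass. -/
theorem IsForcedMildSolution.inner_eq_zero {T : H →ₗ.[ℝ] H} {B : H →L[ℝ] H} {w₀ e : H}
    {w : ℝ → H} (hw : IsForcedMildSolution T B w₀ 0 w)
    (hT : ∀ f g : T.domain, ⟪T f, (g : H)⟫_ℝ = -⟪(f : H), T g⟫_ℝ)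
    (he : ∃ h : e ∈ T.domain, T ⟨e, h⟩ = 0) (hB : ∀ x, ⟪B x, e⟫_ℝ = 0)
    (hw₀ : ⟪w₀, e⟫_ℝ = 0) {t : ℝ} (ht : 0 ≤ t) : ⟪w t, e⟫_ℝ = 0 := by
  obtain ⟨h, hm⟩ := hw.mild t ht
  obtain ⟨hed, hTe⟩ := he
  have h1 := hT ⟨_, h⟩ ⟨e, hed⟩
  rw [hTe, inner_zero_right, neg_zero] at h1
  simp only at h1
  rw [hm, inner_add_left, inner_add_left, inner_sub_left, h1, hB, hw₀]
  simp

end Solutions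

end Kinetic

end

theorem mainTheorem1 {d : ℕ} {Z : Type*} [NormedAddCommGroup Z] [NormedSpace ℝ Z]
    [FiniteDimensional ℝ Z] (Ω : Set Z) (hΩ : Convex ℝ Ω) (hΩ' : (interior Ω).Nonempty)
    (F : Phase d → ℝ) (hF : IsEquilibriumDensity F)
    (T : KSpace F →ₗ.[ℝ] KSpace F) (hT : IsTransportOperator F T)
    (L : KSpace F →L[ℝ] KSpace F) (hL : IsCollisionOperator F L)
    (hTL : IsGlobalEquilibrium F T L)
    (σ : Pos d → Z → ℝ) (hσ_meas : ∀ z ∈ Ω, Measurable fun x => σ x z)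
    (hσ_smooth : ∀ x, ContDiffOn ℝ ∞ (σ x) Ω) (C₂ : ℝ)
    (hσ : ∀ (l : ℕ) (x : Pos d), ∀ z ∈ Ω,
      ‖iteratedFDerivWithin ℝ l (σ x) Ω z‖ / (l.factorial : ℝ) ≤ C₂)
    (α β γ : ℝ) (hα : 0 < α) (hβ : 0 < β)
    (hyp : ∀ z ∈ Ω, Hypocoercive F T (randomCollision F L σ z) α β γ)
    (f₀ : Z → KSpace F) (hf₀_mass : ∀ z ∈ Ω, mass F (f₀ z) = 0)
    (hf₀_smooth : ContDiffOn ℝ ∞ f₀ Ω) (H : ℝ)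
    (hf₀ : ∀ l : ℕ, ∀ z ∈ Ω, ‖iteratedFDerivWithin ℝ l f₀ Ω z‖ ≤ H ^ l)
    (f : ℝ → Z → KSpace F)
    (hf : ∀ z ∈ Ω, IsMildSolution F T (randomCollision F L σ z) (f₀ z) fun t => f t z) :
    (∀ t : ℝ, 0 ≤ t → ContDiffOn ℝ ∞ (f t) Ω ∧ ∀ z₀ ∈ Ω,
      HasFPowerSeriesWithinOnBall (f t) (taylorSeriesWithin (f t) Ω z₀) Ω z₀
        (ENNReal.ofReal (1 / (2 * (1 + H))))) ∧
    ∃ lam : ℝ, 0 < lam ∧ ∀ l : ℕ, ∃ C : ℝ, ∀ t : ℝ, 0 ≤ t → ∀ z ∈ Ω,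
      ‖iteratedFDerivWithin ℝ l (f t) Ω z‖ ≤ C * Real.exp (-lam * t) := by
  have hΩne : Ω.Nonempty := hΩ'.mono interior_subset
  obtain ⟨z₁, hz₁⟩ := hΩne
  have hu : UniqueDiffOn ℝ Ω := uniqueDiffOn_convex hΩ hΩ'
  have hσ' : ∀ (l : ℕ) (x : Pos d), ∀ z ∈ Ω,
      ‖iteratedFDerivWithin ℝ l (σ x) Ω z‖ ≤ l.factorial * C₂ := fun l x z hz => by
    have h := hσ l x z hz
    rwa [div_le_iff₀ (by positivity), mul_comm] at h
  have hC₂ : 0 ≤ C₂ := by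
    simpa using (norm_nonneg _).trans (hσ' 0 0 z₁ hz₁)
  have hH : 0 ≤ H := by
    simpa using (norm_nonneg _).trans (hf₀ 1 z₁ hz₁)
  set B : Z → KSpace F →L[ℝ] KSpace F := fun z => (mulOp F fun x => σ x z) ∘L L with hBdef
  obtain ⟨hBs, hBd⟩ := contDiffOn_mulOp_comp (F := F) hΩ hΩ' hσ_meas hσ_smooth hσ' L
  set m := C₂ * ‖L‖ with hm
  have hm0 : 0 ≤ m := mul_nonneg hC₂ (norm_nonneg L)
  have hB : ∀ z ∈ Ω, ∀ g, B z g = randomCollision F L σ z g := fun z hz g =>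
    mulOp_apply ⟨hσ_meas z hz, C₂, fun x => by simpa using hσ' 0 x z hz⟩ (L g)
  have hM := (hyp z₁ hz₁).isMacroscopic hF hT hTL
  have hBsymm : ∀ z ∈ Ω, ∀ g h, ⟪B z g, h⟫_ℝ = ⟪g, B z h⟫_ℝ := fun z hz g h => by
    rw [hB z hz, hB z hz]
    exact (hyp z hz).symmetric g h
  have hBP : ∀ z g, B z (localProj F g) = 0 := fun z g => by
    rw [hBdef, ContinuousLinearMap.comp_apply, hL.apply_localProj, map_zero]
  have hBm : ∀ z ∈ Ω, ∀ g, α * ‖g - localProj F g‖ ^ 2 ≤ -⟪B z g, g⟫_ℝ := fun z hz g => by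
    rw [hB z hz]
    exact (hyp z hz).microscopic g
  have hBe : ∀ z ∈ Ω, ∀ x, ⟪B z x, equilibrium hF⟫_ℝ = 0 := fun z hz x => by
    rw [hBsymm z hz, ← localProj_equilibrium hF, hBP, inner_zero_right]
  have hsol : ∀ z ∈ Ω, IsForcedMildSolution T (B z) (f₀ z) 0 fun t => f t z := fun z hz => by
    refine ⟨continuousOn_const, (hf z hz).1, fun t ht => ?_⟩
    obtain ⟨h, h1⟩ := (hf z hz).2 t ht
    refine ⟨h, ?_⟩
    simp only at h1
    rw [hB z hz, h1]
    simp
  have hfe : ∀ z ∈ Ω, ∀ t, 0 ≤ t → ⟪f t z, equilibrium hF⟫_ℝ = 0 := fun z hz t ht =>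
    (hsol z hz).inner_eq_zero hT.skew_symmetric hM.transport_apply (hBe z hz)
      ((inner_equilibrium hF _).trans (hf₀_mass z hz)) ht
  refine ⟨fun t ht => ?_, ?_⟩
  · -- `μ` is so large that `1 + √(2 / μ) m ≤ 2`
    set μ := 1 + 2 * m ^ 2 with hμ
    have hμ1 : 1 ≤ μ := by linarith [sq_nonneg m]
    have hE : ∀ z ∈ Ω, ∃ G, IsEnergyForm T (equilibrium hF) (B z) G μ μ 2 := fun z hz =>
      ⟨_, isEnergyForm_id _ hT.skew_symmetric (fun g => by
        linarith [hBm z hz g, mul_nonneg hα.le (sq_nonneg ‖g - localProj F g‖)]) hμ1⟩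
    obtain ⟨h1, h2⟩ := contDiffOn_and_norm_iteratedFDerivWithin_le hu hBs hBd hBe hf₀_smooth hH
      hf₀ (by linarith) le_rfl hE hsol hfe ht
    have hρ : √(2 / μ) * m ≤ 1 := by
      have hsq : (√(2 / μ) * m) ^ 2 ≤ 1 := by
        rw [mul_pow, Real.sq_sqrt (by positivity), div_mul_eq_mul_div, div_le_one (by linarith)]
        linarith
      exact (abs_le.1 ((sq_le_one_iff_abs_le_one _).1 hsq)).2
    refine ⟨h1, fun z₀ hz₀ => ?_⟩
    refine hasFPowerSeriesWithinOnBall_taylorSeriesWithin hΩ hu h1 hz₀ h2 (by positivity)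
      (by positivity) ?_
    rw [mul_one_div, div_le_one (by positivity)]
    linarith
  · obtain ⟨lam, a, C, hlam, ha, hC, hG⟩ := hM.exists_isEnergyForm hβ (γ := γ) hα
    have hE : ∀ z ∈ Ω, ∃ G, IsEnergyForm T (equilibrium hF) (B z) G (-lam) a C := fun z hz =>
      hG (B z) (hBsymm z hz) (hBP z) (hBm z hz) fun g h => by
        rw [hB z hz]
        exact (hyp z hz).auxiliary g h
    refine ⟨lam, hlam, fun l => ⟨l.factorial * (√(2 * C) * Real.exp H * (1 + √(C / a) * m) ^ l),
      fun t ht z hz => ?_⟩⟩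
    obtain ⟨-, h2⟩ := contDiffOn_and_norm_iteratedFDerivWithin_le hu hBs hBd hBe hf₀_smooth hH
      hf₀ ha hC hE hsol hfe ht
    refine (h2 l z hz).trans_eq ?_
    ring
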